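/- Rings are associative with identity and modules are unitary. Let $A$ and $B$ be rings, $U$ a $(B,A)$-bimodule, and $T=\begin{pmatrix}A&0\\U&B\end{pmatrix}$ the formal triangular matrix ring. A left $T$-module is identified with a triple $M=\begin{pmatrix}M_1\\M_2\end{pmatrix}_{\varphi^M}$, where $M_1$ is a left $A$-module, $M_2$ is a left $B$-module and $\varphi^M\colon U\otimes_A M_1\to M_2$ is a homomorphism of left $B$-modules; here $T$ acts on column vectors by $$\begin{pmatrix}a&0\\u&b\end{pmatrix}\begin{pmatrix}m_1\\m_2\end{pmatrix}=\begin{pmatrix}am_1\\ \varphi^M(u\otimes m_1)+bm_2\end{pmatrix}.$$ A left $R$-module $X$ is called Ding projective if there is an exact sequence $\cdots\to P^{-1}\to P^0\to P^1\to\cdots$ of projective left $R$-modules with $X\cong\ker(P^0\to P^1)$ which remains exact after applying $\operatorname{Hom}_R(-,F)$ for every flat left $R$-module $F$. Theorem 3.4. Assume that the right $A$-module $U_A$ and the left $B$-module ${}_BU$ have finite flat dimension, and let $M=\begin{pmatrix}M_1\\M_2\end{pmatrix}_{\varphi^M}$ be a left $T$-module. The following conditions are equivalent: 1. $M$ is a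 Ding projective left $T$-module. 2. $M_1$ is a Ding projective left $A$-module, $M_2/\operatorname{im}(\varphi^M)$ is a Ding projective left $B$-module, and $\varphi^M$ is a monomorphism. If these conditions hold, then $U\otimes_A M_1$ is a Ding projective left $B$-module if and only if $M_2$ is a Ding projective left $B$-module. -/

import Mathlib

open scoped TensorProduct

universe u

/-! ### Tensor product over a not necessarily commutative ring

A right `R`-module is a `Module Rᵐᵒᵖ N`; the action of `r` on the right is `MulOpposite.op r • n`. -/

section BalTensor

/-- The subgroup of `N ⊗[ℤ] M` generated by all `(n r) ⊗ m - n ⊗ (r m)`. -/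
def balancedRel (R N M : Type*) [Ring R] [AddCommGroup N] [Module Rᵐᵒᵖ N]
    [AddCommGroup M] [Module R M] : AddSubgroup (N ⊗[ℤ] M) :=
  AddSubgroup.closure
    {x | ∃ (n : N) (r : R) (m : M), x = (MulOpposite.op r • n) ⊗ₜ[ℤ] m - n ⊗ₜ[ℤ] (r • m)}

/-- The tensor product `N ⊗_R M` of a right `R`-module `N` and a left `R`-module `M`. -/
def BalTensor (R N M : Type*) [Ring R] [AddCommGroup N] [Module Rᵐᵒᵖ N]
    [AddCommGroup M] [Module R M] : Type _ :=
  (N ⊗[ℤ] M) ⧸ balancedRel R N M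

namespace BalTensor

instance instAddCommGroup (R N M : Type*) [Ring R] [AddCommGroup N] [Module Rᵐᵒᵖ N]
    [AddCommGroup M] [Module R M] : AddCommGroup (BalTensor R N M) :=
  inferInstanceAs (AddCommGroup ((N ⊗[ℤ] M) ⧸ balancedRel R N M))

/-- The quotient map from the tensor product over `ℤ`. -/
def proj (R N M : Type*) [Ring R] [AddCommGroup N] [Module Rᵐᵒᵖ N]
    [AddCommGroup M] [Module R M] : N ⊗[ℤ] M →+ BalTensor R N M :=
  QuotientAddGroup.mk' (balancedRel R N M)

/-- The pure tensor `n ⊗ m`. -/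
def tmul (R : Type*) {N M : Type*} [Ring R] [AddCommGroup N] [Module Rᵐᵒᵖ N]
    [AddCommGroup M] [Module R M] (n : N) (m : M) : BalTensor R N M :=
  proj R N M (n ⊗ₜ[ℤ] m)

section basic

variable {R N M : Type*} [Ring R] [AddCommGroup N] [Module Rᵐᵒᵖ N] [AddCommGroup M] [Module R M]

theorem tmul_add (n : N) (m m' : M) : tmul R n (m + m') = tmul R n m + tmul R n m' := by
  simp only [tmul, TensorProduct.tmul_add, map_add]

theorem add_tmul (n n' : N) (m : M) : tmul R (n + n') m = tmul R n m + tmul R n' m := by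
  simp only [tmul, TensorProduct.add_tmul, map_add]

theorem zero_tmul (m : M) : tmul R (0 : N) m = 0 := by
  simp only [tmul, TensorProduct.zero_tmul, map_zero]

theorem tmul_zero (n : N) : tmul R n (0 : M) = 0 := by
  simp only [tmul, TensorProduct.tmul_zero, map_zero]

theorem smul_tmul (n : N) (r : R) (m : M) :
    tmul R (MulOpposite.op r • n) m = tmul R n (r • m) := by
  refine sub_eq_zero.mp ?_
  rw [tmul, tmul, ← map_sub]
  exact (QuotientAddGroup.eq_zero_iff _).mpr (AddSubgroup.subset_closure ⟨n, r, m, rfl⟩)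

theorem induction_on {motive : BalTensor R N M → Prop} (x : BalTensor R N M)
    (zero : motive 0) (tmul : ∀ n m, motive (tmul R n m))
    (add : ∀ x y, motive x → motive y → motive (x + y)) : motive x := by
  obtain ⟨y, rfl⟩ := QuotientAddGroup.mk'_surjective (balancedRel R N M) x
  induction y using TensorProduct.induction_on with
  | zero => exact zero
  | tmul n m => exact tmul n m
  | add a b ha hb => exact add _ _ ha hb

theorem addHom_ext {G : Type*} [AddCommGroup G] {f g : BalTensor R N M →+ G}
    (h : ∀ n m, f (tmul R n m) = g (tmul R n m)) : f = g := by
  ext x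
  induction x using induction_on with
  | zero => simp
  | tmul n m => exact h n m
  | add x y hx hy => rw [map_add, map_add, hx, hy]

/-- The universal property: biadditive balanced maps induce additive maps on `N ⊗_R M`. -/
def lift {G : Type*} [AddCommGroup G] (f : N →+ M →+ G)
    (hf : ∀ (n : N) (r : R) (m : M), f (MulOpposite.op r • n) m = f n (r • m)) :
    BalTensor R N M →+ G :=
  QuotientAddGroup.lift (balancedRel R N M)
    (TensorProduct.liftAddHom f (fun z n m => by simp)) (by
      refine (AddSubgroup.closure_le _).mpr ?_
      rintro _ ⟨n, r, m, rfl⟩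
      simp [hf])

theorem lift_tmul {G : Type*} [AddCommGroup G] (f : N →+ M →+ G)
    (hf : ∀ (n : N) (r : R) (m : M), f (MulOpposite.op r • n) m = f n (r • m)) (n : N) (m : M) :
    lift f hf (tmul R n m) = f n m :=
  rfl

end basic

/-- The additive map `f ⊗ g : N ⊗_R M → N' ⊗_R M'`, `n ⊗ m ↦ f n ⊗ g m`. -/
def map {R N M N' M' : Type*} [Ring R] [AddCommGroup N] [Module Rᵐᵒᵖ N] [AddCommGroup M]
    [Module R M] [AddCommGroup N'] [Module Rᵐᵒᵖ N'] [AddCommGroup M'] [Module R M']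
    (f : N →ₗ[Rᵐᵒᵖ] N') (g : M →ₗ[R] M') : BalTensor R N M →+ BalTensor R N' M' :=
  lift
    (AddMonoidHom.mk' (fun n => AddMonoidHom.mk' (fun m => tmul R (f n) (g m))
      (fun m m' => by rw [map_add, tmul_add]))
      (fun n n' => by ext m; simp [add_tmul]))
    (fun n r m => by
      change tmul R (f (MulOpposite.op r • n)) (g m) = tmul R (f n) (g (r • m))
      rw [map_smul, map_smul, smul_tmul])

theorem map_tmul {R N M N' M' : Type*} [Ring R] [AddCommGroup N] [Module Rᵐᵒᵖ N] [AddCommGroup M]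
    [Module R M] [AddCommGroup N'] [Module Rᵐᵒᵖ N'] [AddCommGroup M'] [Module R M']
    (f : N →ₗ[Rᵐᵒᵖ] N') (g : M →ₗ[R] M') (n : N) (m : M) :
    map f g (tmul R n m) = tmul R (f n) (g m) :=
  lift_tmul _ _ n m

section leftModule

variable {S R N M : Type*} [Ring S] [Ring R] [AddCommGroup N] [Module Rᵐᵒᵖ N] [Module S N]
  [SMulCommClass S Rᵐᵒᵖ N] [AddCommGroup M] [Module R M]

/-- For an `(S, R)`-bimodule `N`, the group `N ⊗_R M` is a left `S`-module through
`s • (n ⊗ m) = (s n) ⊗ m`. -/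
instance instSMul : SMul S (BalTensor R N M) where
  smul s := map
    { toFun := fun n => s • n
      map_add' := smul_add s
      map_smul' := fun r n => smul_comm s r n } LinearMap.id

theorem smul_tmul_left (s : S) (n : N) (m : M) : s • tmul R n m = tmul R (s • n) m :=
  map_tmul _ _ n m

instance instModule : Module S (BalTensor R N M) where
  smul_zero s := map_zero (map _ _)
  smul_add s := map_add (map _ _)
  one_smul x := by
    induction x using induction_on with
    | zero => exact map_zero (map _ _)
    | tmul n m => rw [smul_tmul_left, one_smul]
    | add x y hx hy => exact (map_add (map _ _) x y).trans (congrArg₂ (· + ·) hx hy)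
  mul_smul s t x := by
    have hadd : ∀ (s : S) (x y : BalTensor R N M), s • (x + y) = s • x + s • y :=
      fun s => map_add (map _ _)
    have hzero : ∀ s : S, s • (0 : BalTensor R N M) = 0 := fun s => map_zero (map _ _)
    induction x using induction_on with
    | zero => simp only [hzero]
    | tmul n m => simp only [smul_tmul_left, mul_smul]
    | add x y hx hy => simp only [hadd, hx, hy]
  add_smul s t x := by
    have hadd : ∀ (s : S) (x y : BalTensor R N M), s • (x + y) = s • x + s • y :=
      fun s => map_add (map _ _)
    have hzero : ∀ s : S, s • (0 : BalTensor R N M) = 0 := fun s => map_zero (map _ _)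
    induction x using induction_on with
    | zero => simp only [hzero, add_zero]
    | tmul n m => simp only [smul_tmul_left, add_smul, add_tmul]
    | add x y hx hy => simp only [hadd, hx, hy]; abel
  zero_smul x := by
    have hadd : ∀ (s : S) (x y : BalTensor R N M), s • (x + y) = s • x + s • y :=
      fun s => map_add (map _ _)
    induction x using induction_on with
    | zero => exact map_zero (map _ _)
    | tmul n m => rw [smul_tmul_left, zero_smul, zero_tmul]
    | add x y hx hy => rw [hadd, hx, hy, add_zero]

end leftModule

end BalTensor

end BalTensor

/-! ### Flatness and finite flat dimension, for left and for right modules -/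

/-- A left `R`-module `F` is flat if `- ⊗_R F` preserves injectivity of maps of right modules. -/
def IsFlatLeft (R : Type u) [Ring R] (F : Type u) [AddCommGroup F] [Module R F] : Prop :=
  ∀ (N N' : Type u) [AddCommGroup N] [AddCommGroup N'] [Module Rᵐᵒᵖ N] [Module Rᵐᵒᵖ N']
    (f : N →ₗ[Rᵐᵒᵖ] N'), Function.Injective f →
      Function.Injective (BalTensor.map f (LinearMap.id : F →ₗ[R] F))

/-- A right `R`-module `F` is flat if `F ⊗_R -` preserves injectivity of maps of left modules. -/
def IsFlatRight (R : Type u) [Ring R] (F : Type u) [AddCommGroup F] [Module Rᵐᵒᵖ F] : Prop :=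
  ∀ (N N' : Type u) [AddCommGroup N] [AddCommGroup N'] [Module R N] [Module R N']
    (f : N →ₗ[R] N'), Function.Injective f →
      Function.Injective (BalTensor.map (LinearMap.id : F →ₗ[Rᵐᵒᵖ] F) f)

/-- `fd X ≤ n` for a left `R`-module `X`: there is an exact sequence
`0 → F_n → ⋯ → F_0 → X → 0` of left modules with all `F_i` flat
(recursively, through the kernel of `F_0 → X`). -/
def FlatDimLELeft (R : Type u) [Ring R] :
    ℕ → ∀ (X : Type u) [AddCommGroup X] [Module R X], Prop
  | 0, X, _, _ => IsFlatLeft R X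
  | n + 1, X, _, _ => ∃ (F : ModuleCat.{u} R) (p : F →ₗ[R] X),
      IsFlatLeft R F ∧ Function.Surjective p ∧ FlatDimLELeft R n (LinearMap.ker p)

/-- `fd X ≤ n` for a right `R`-module `X`. -/
def FlatDimLERight (R : Type u) [Ring R] :
    ℕ → ∀ (X : Type u) [AddCommGroup X] [Module Rᵐᵒᵖ X], Prop
  | 0, X, _, _ => IsFlatRight R X
  | n + 1, X, _, _ => ∃ (F : ModuleCat.{u} Rᵐᵒᵖ) (p : F →ₗ[Rᵐᵒᵖ] X),
      IsFlatRight R F ∧ Function.Surjective p ∧ FlatDimLERight R n (LinearMap.ker p)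

/-- The left `R`-module `X` has finite flat dimension. -/
def FiniteFlatDimLeft (R : Type u) [Ring R] (X : Type u) [AddCommGroup X] [Module R X] : Prop :=
  ∃ n : ℕ, FlatDimLELeft R n X

/-- The right `R`-module `X` has finite flat dimension. -/
def FiniteFlatDimRight (R : Type u) [Ring R] (X : Type u) [AddCommGroup X] [Module Rᵐᵒᵖ X] :
    Prop :=
  ∃ n : ℕ, FlatDimLERight R n X

/-! ### Ding projective modules -/

/-- A left `R`-module `M` is Ding projective if there is an exact sequence
`⋯ → P⁻¹ → P⁰ → P¹ → ⋯` of projective left `R`-modules with `M ≅ ker (P⁰ → P¹)` which remains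
exact after applying `Hom_R(-, F)` for every flat left `R`-module `F`. -/
def IsDingProjective (R : Type u) [Ring R] (M : Type u) [AddCommGroup M] [Module R M] : Prop :=
  ∃ (P : ℤ → ModuleCat.{u} R) (d : ∀ i : ℤ, P i →ₗ[R] P (i + 1)),
    (∀ i, Module.Projective R (P i)) ∧
    (∀ i, Function.Exact (d i) (d (i + 1))) ∧
    (∀ (F : Type u) [AddCommGroup F] [Module R F], IsFlatLeft R F →
      ∀ i, Function.Exact
        (fun g : P (i + 1 + 1) →ₗ[R] F => g ∘ₗ d (i + 1))
        (fun g : P (i + 1) →ₗ[R] F => g ∘ₗ d i)) ∧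
    Nonempty (M ≃ₗ[R] LinearMap.ker (d 0))

/-! ### The formal triangular matrix ring and its modules -/

/-- The formal triangular matrix ring with rows `(A, 0)` and `(U, B)`, for a
`(B, A)`-bimodule `U`. The entries are `a`, `u`, `b`. -/
@[ext]
structure TriRing (A B U : Type*) where
  /-- the upper left entry -/
  a : A
  /-- the lower left entry -/
  u : U
  /-- the lower right entry -/
  b : B

namespace TriRing

variable {A B U : Type*} [Ring A] [Ring B] [AddCommGroup U]

instance instZero : Zero (TriRing A B U) := ⟨⟨0, 0, 0⟩⟩
instance instOne : One (TriRing A B U) := ⟨⟨1, 0, 1⟩⟩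
instance instAdd : Add (TriRing A B U) := ⟨fun s t => ⟨s.a + t.a, s.u + t.u, s.b + t.b⟩⟩
instance instNeg : Neg (TriRing A B U) := ⟨fun s => ⟨-s.a, -s.u, -s.b⟩⟩

@[simp] theorem zero_a : (0 : TriRing A B U).a = 0 := rfl
@[simp] theorem zero_u : (0 : TriRing A B U).u = 0 := rfl
@[simp] theorem zero_b : (0 : TriRing A B U).b = 0 := rfl
@[simp] theorem one_a : (1 : TriRing A B U).a = 1 := rfl
@[simp] theorem one_u : (1 : TriRing A B U).u = 0 := rfl
@[simp] theorem one_b : (1 : TriRing A B U).b = 1 := rfl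
@[simp] theorem add_a (s t : TriRing A B U) : (s + t).a = s.a + t.a := rfl
@[simp] theorem add_u (s t : TriRing A B U) : (s + t).u = s.u + t.u := rfl
@[simp] theorem add_b (s t : TriRing A B U) : (s + t).b = s.b + t.b := rfl
@[simp] theorem neg_a (s : TriRing A B U) : (-s).a = -s.a := rfl
@[simp] theorem neg_u (s : TriRing A B U) : (-s).u = -s.u := rfl
@[simp] theorem neg_b (s : TriRing A B U) : (-s).b = -s.b := rfl

variable [Module B U] [Module Aᵐᵒᵖ U]

/-- Matrix multiplication: the lower left entry of a product is `u a' + b u'`. -/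
instance instMul : Mul (TriRing A B U) :=
  ⟨fun s t => ⟨s.a * t.a, MulOpposite.op t.a • s.u + s.b • t.u, s.b * t.b⟩⟩

@[simp] theorem mul_a (s t : TriRing A B U) : (s * t).a = s.a * t.a := rfl
@[simp] theorem mul_u (s t : TriRing A B U) :
    (s * t).u = MulOpposite.op t.a • s.u + s.b • t.u := rfl
@[simp] theorem mul_b (s t : TriRing A B U) : (s * t).b = s.b * t.b := rfl

instance instRing [SMulCommClass B Aᵐᵒᵖ U] : Ring (TriRing A B U) where
  add_assoc _ _ _ := by ext <;> simp [add_assoc]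
  zero_add _ := by ext <;> simp
  add_zero _ := by ext <;> simp
  add_comm _ _ := by ext <;> simp [add_comm]
  neg_add_cancel _ := by ext <;> simp
  nsmul := nsmulRec
  zsmul := zsmulRec
  mul_assoc r s t := by
    ext
    · simp [mul_assoc]
    · simp [mul_smul, smul_add, add_assoc, smul_comm r.b (MulOpposite.op t.a) s.u]
    · simp [mul_assoc]
  one_mul _ := by ext <;> simp
  mul_one _ := by ext <;> simp
  zero_mul _ := by ext <;> simp
  mul_zero _ := by ext <;> simp
  left_distrib _ _ _ := by
    ext
    · simp [mul_add]
    · simp [add_smul, smul_add]; abel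
    · simp [mul_add]
  right_distrib _ _ _ := by
    ext
    · simp [add_mul]
    · simp [add_smul, smul_add]; abel
    · simp [add_mul]

end TriRing

section TriModule

variable {A B U M₁ M₂ : Type*} [Ring A] [Ring B] [AddCommGroup U] [Module B U] [Module Aᵐᵒᵖ U]
  [SMulCommClass B Aᵐᵒᵖ U] [AddCommGroup M₁] [Module A M₁] [AddCommGroup M₂] [Module B M₂]

/-- The left module over the triangular matrix ring given by a triple `(M₁, M₂, φ)`, where
`φ : U ⊗_A M₁ → M₂` is `B`-linear: column vectors `(m₁, m₂)` with the action
`(a, u, b) • (m₁, m₂) = (a m₁, φ (u ⊗ m₁) + b m₂)`. -/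
def TriModule (_φ : BalTensor A U M₁ →ₗ[B] M₂) : Type _ := M₁ × M₂

namespace TriModule

instance instAddCommGroup (φ : BalTensor A U M₁ →ₗ[B] M₂) : AddCommGroup (TriModule φ) :=
  inferInstanceAs (AddCommGroup (M₁ × M₂))

instance instSMul (φ : BalTensor A U M₁ →ₗ[B] M₂) : SMul (TriRing A B U) (TriModule φ) where
  smul t m := (t.a • m.1, φ (BalTensor.tmul A t.u m.1) + t.b • m.2)

theorem smul_def (φ : BalTensor A U M₁ →ₗ[B] M₂) (t : TriRing A B U) (m : TriModule φ) :
    t • m = ((t.a • m.1, φ (BalTensor.tmul A t.u m.1) + t.b • m.2) : M₁ × M₂) := rfl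

instance instModule (φ : BalTensor A U M₁ →ₗ[B] M₂) : Module (TriRing A B U) (TriModule φ) where
  one_smul m := by
    refine Prod.ext (one_smul A m.1) ?_
    change φ (BalTensor.tmul A 0 m.1) + (1 : B) • m.2 = m.2
    rw [BalTensor.zero_tmul, map_zero, zero_add, one_smul]
  mul_smul s t m := by
    refine Prod.ext (mul_smul s.a t.a m.1) ?_
    change φ (BalTensor.tmul A (MulOpposite.op t.a • s.u + s.b • t.u) m.1) + (s.b * t.b) • m.2
      = φ (BalTensor.tmul A s.u (t.a • m.1)) +
        s.b • (φ (BalTensor.tmul A t.u m.1) + t.b • m.2)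
    rw [BalTensor.add_tmul, BalTensor.smul_tmul, ← BalTensor.smul_tmul_left, map_add, map_smul,
      smul_add, mul_smul, add_assoc]
  smul_zero t := by
    refine Prod.ext (smul_zero t.a) ?_
    change φ (BalTensor.tmul A t.u 0) + t.b • (0 : M₂) = 0
    rw [BalTensor.tmul_zero, map_zero, smul_zero, add_zero]
  smul_add t m n := by
    refine Prod.ext (smul_add t.a m.1 n.1) ?_
    change φ (BalTensor.tmul A t.u (m.1 + n.1)) + t.b • (m.2 + n.2) =
      (φ (BalTensor.tmul A t.u m.1) + t.b • m.2) + (φ (BalTensor.tmul A t.u n.1) + t.b • n.2)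
    rw [BalTensor.tmul_add, map_add, smul_add]
    abel
  add_smul s t m := by
    refine Prod.ext (add_smul s.a t.a m.1) ?_
    change φ (BalTensor.tmul A (s.u + t.u) m.1) + (s.b + t.b) • m.2 =
      (φ (BalTensor.tmul A s.u m.1) + s.b • m.2) + (φ (BalTensor.tmul A t.u m.1) + t.b • m.2)
    rw [BalTensor.add_tmul, map_add, add_smul]
    abel
  zero_smul m := by
    refine Prod.ext (zero_smul A m.1) ?_
    change φ (BalTensor.tmul A 0 m.1) + (0 : B) • m.2 = 0
    rw [BalTensor.zero_tmul, map_zero, zero_smul, add_zero]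

end TriModule

end TriModule

/-! Complete complexes are handled through a coinductive criterion, `IsDingClass`: if every member
of a class is the cokernel and the kernel in short exact sequences with projective middle term and
other end in the class, and has no `Ext¹` into flat modules, then all members are Ding projective,
by splicing. The Ding projective modules themselves form such a class
(`isDingClass_isDingProjective`). Each claim of Ding projectivity thus needs two short exact
sequences and one `Ext¹` computation. By dimension shifting, `Ext¹(G, F) = 0` for `G` Ding
projective and `F` of finite flat dimension.

The flat dimension of `U` over `B` controls how flatness passes between the rings. A flat `A`-module
inflated along `T → A` has finite flat dimension over `T`, because the kernel of `T → A` is the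
lower row `(U, B)`. The lower entry of a flat `T`-module is its tensor product with that row, so it
has finite flat dimension over `B`. The flat dimension of `U` over `A` gives `Tor₁(U, G) = 0` for
every Ding projective `G`, so `U ⊗_A -` keeps the relevant sequences exact.

Necessity: a short exact sequence of `T`-modules is one in each entry. The upper entries of Ding
projective modules form a Ding class since `Hom_T(M, F) = Hom_A(M₁, F)` for inflated `F`. If `M`
embeds in a projective `P` with Ding projective cokernel, then `U ⊗ M₁ → U ⊗ P₁ → P₂` is injective
and factors through `φ`. Once all structure maps are injective, the snake lemma makes the cokernels
exact, and `Hom_T(M, F) = Hom_B(coker φ, F)` finishes the argument.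

Sufficiency: `M` is an extension of `(0, coker φ)` by `(M₁, U ⊗ M₁)`. Both ends are Ding projective,
and Ding projectivity is closed under extensions. The last claim concerns `0 → U ⊗ M₁ → M₂ → coker φ
→ 0`; it follows from closure under extensions and under kernels of epimorphisms. -/

/-! ### Short exact sequences and the three-by-three chase -/

/-- `0 → X → Y → Z → 0` is exact. -/
structure IsShortExact {R X Y Z : Type*} [Ring R] [AddCommGroup X] [Module R X] [AddCommGroup Y]
    [Module R Y] [AddCommGroup Z] [Module R Z] (i : X →ₗ[R] Y) (p : Y →ₗ[R] Z) : Prop where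
  inj : Function.Injective i
  exact : Function.Exact i p
  surj : Function.Surjective p

namespace IsShortExact

variable {R X Y Z : Type*} [Ring R] [AddCommGroup X] [Module R X] [AddCommGroup Y]
    [Module R Y] [AddCommGroup Z] [Module R Z]

theorem zero {i : X →ₗ[R] Y} {p : Y →ₗ[R] Z} (h : IsShortExact i p) (x : X) : p (i x) = 0 :=
  h.exact.apply_apply_eq_zero x

theorem of_mkQ (i : X →ₗ[R] Y) (hi : Function.Injective i) :
    IsShortExact i (LinearMap.range i).mkQ where
  inj := hi
  exact := LinearMap.exact_iff.mpr (by simp)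
  surj := Submodule.mkQ_surjective _

theorem of_ker (p : Y →ₗ[R] Z) (hp : Function.Surjective p) :
    IsShortExact (LinearMap.ker p).subtype p where
  inj := Subtype.val_injective
  exact := LinearMap.exact_iff.mpr (by simp)
  surj := hp

end IsShortExact

theorem exists_surjective_free (R : Type u) [Ring R] (X : Type u) [AddCommGroup X] [Module R X] :
    ∃ (P : ModuleCat.{u} R) (p : P →ₗ[R] X), Module.Projective R P ∧ Function.Surjective p := by
  have h1 : Module.Projective R (X →₀ R) := inferInstance
  have h2 := Finsupp.linearCombination_id_surjective R X
  generalize Finsupp.linearCombination R (id : X → X) = q at h2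
  exact ⟨ModuleCat.of R (X →₀ R), q, h1, h2⟩

/-- The chase behind the symmetry of `Tor₁` in its two arguments. -/
theorem injective_of_three_by_three {KW KF KV QW QF QV NW NF : Type*}
    [AddCommGroup KW] [AddCommGroup KF] [AddCommGroup KV] [AddCommGroup QW] [AddCommGroup QF]
    [AddCommGroup QV] [AddCommGroup NW] [AddCommGroup NF]
    (a : KW →+ KF) (b : KF →+ KV) (c : QW →+ QF) (d : QF →+ QV) (e : NW →+ NF)
    (kw : KW →+ QW) (kf : KF →+ QF) (kv : KV →+ QV) (qw : QW →+ NW) (qf : QF →+ NF)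
    (hab : ∀ x, b x = 0 → ∃ y, a y = x) (hc : Function.Injective c)
    (hdc : ∀ x, d (c x) = 0) (hkv : Function.Injective kv)
    (hqw : Function.Surjective qw) (hkq : ∀ x, qw (kw x) = 0)
    (hf : ∀ x, qf x = 0 → ∃ y, kf y = x)
    (h1 : ∀ x, kf (a x) = c (kw x)) (h2 : ∀ x, kv (b x) = d (kf x))
    (h3 : ∀ x, qf (c x) = e (qw x)) : Function.Injective e := by
  refine (injective_iff_map_eq_zero e).mpr fun x hx => ?_
  obtain ⟨y, rfl⟩ := hqw x
  rw [← h3] at hx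
  obtain ⟨w, hw⟩ := hf _ hx
  have hbw : b w = 0 := hkv (by rw [h2, hw, hdc, map_zero])
  obtain ⟨v, rfl⟩ := hab w hbw
  have : y = kw v := hc (by rw [← hw, h1])
  rw [this, hkq]

/-! ### Functoriality and right exactness of the tensor product -/

namespace BalTensor

section

variable {R N M G : Type*} [Ring R] [AddCommGroup N] [Module Rᵐᵒᵖ N] [AddCommGroup M] [Module R M]
  [AddCommGroup G]

/-- The additive map out of `N ⊗_R M` attached to a biadditive balanced function. -/
def lift₂ (f : N → M → G) (hl : ∀ n n' m, f (n + n') m = f n m + f n' m)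
    (hr : ∀ n m m', f n (m + m') = f n m + f n m')
    (hb : ∀ n (r : R) m, f (MulOpposite.op r • n) m = f n (r • m)) : BalTensor R N M →+ G :=
  lift (AddMonoidHom.mk' (fun n => AddMonoidHom.mk' (f n) (hr n))
    (fun n n' => by ext m; exact hl n n' m)) hb

@[simp] theorem lift₂_tmul (f : N → M → G) (hl hr) (hb) (n : N) (m : M) :
    lift₂ f hl hr hb (tmul R n m) = f n m := rfl

end

section

variable {R N M N' M' N'' M'' : Type*} [Ring R] [AddCommGroup N] [Module Rᵐᵒᵖ N]
  [AddCommGroup M] [Module R M] [AddCommGroup N'] [Module Rᵐᵒᵖ N'] [AddCommGroup M'] [Module R M']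
  [AddCommGroup N''] [Module Rᵐᵒᵖ N''] [AddCommGroup M''] [Module R M'']

theorem map_map (f : N →ₗ[Rᵐᵒᵖ] N') (g : M →ₗ[R] M') (f' : N' →ₗ[Rᵐᵒᵖ] N'') (g' : M' →ₗ[R] M'')
    (x : BalTensor R N M) : map f' g' (map f g x) = map (f' ∘ₗ f) (g' ∘ₗ g) x := by
  induction x using induction_on with
  | zero => simp
  | tmul n m => simp [map_tmul]
  | add x y hx hy => simp only [map_add, hx, hy]

theorem map_id_id (x : BalTensor R N M) :
    map (LinearMap.id : N →ₗ[Rᵐᵒᵖ] N) (LinearMap.id : M →ₗ[R] M) x = x := by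
  induction x using induction_on with
  | zero => simp
  | tmul n m => simp [map_tmul]
  | add x y hx hy => simp only [map_add, hx, hy]

theorem map_comm (f : N →ₗ[Rᵐᵒᵖ] N') (g : M →ₗ[R] M') (x : BalTensor R N M) :
    map f (LinearMap.id : M' →ₗ[R] M') (map (LinearMap.id : N →ₗ[Rᵐᵒᵖ] N) g x) =
      map (LinearMap.id : N' →ₗ[Rᵐᵒᵖ] N') g (map f (LinearMap.id : M →ₗ[R] M) x) := by
  simp [map_map]

theorem map_left_eq_zero {f : N →ₗ[Rᵐᵒᵖ] N'} {f' : N' →ₗ[Rᵐᵒᵖ] N''} (h : ∀ x, f' (f x) = 0)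
    (x : BalTensor R N M) :
    map f' (LinearMap.id : M →ₗ[R] M) (map f (LinearMap.id : M →ₗ[R] M) x) = 0 := by
  induction x using induction_on with
  | zero => simp
  | tmul n m => simp [map_tmul, h, zero_tmul]
  | add x y hx hy => simp only [map_add, hx, hy, add_zero]

theorem map_right_eq_zero {g : M →ₗ[R] M'} {g' : M' →ₗ[R] M''} (h : ∀ x, g' (g x) = 0)
    (x : BalTensor R N M) :
    map (LinearMap.id : N →ₗ[Rᵐᵒᵖ] N) g' (map (LinearMap.id : N →ₗ[Rᵐᵒᵖ] N) g x) = 0 := by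
  induction x using induction_on with
  | zero => simp
  | tmul n m => simp [map_tmul, h, tmul_zero]
  | add x y hx hy => simp only [map_add, hx, hy, add_zero]

theorem map_surjective {f : N →ₗ[Rᵐᵒᵖ] N'} {g : M →ₗ[R] M'} (hf : Function.Surjective f)
    (hg : Function.Surjective g) : Function.Surjective (map f g) := by
  intro x
  induction x using induction_on with
  | zero => exact ⟨0, map_zero _⟩
  | tmul n m =>
    obtain ⟨n, rfl⟩ := hf n
    obtain ⟨m, rfl⟩ := hg m
    exact ⟨tmul R n m, map_tmul _ _ _ _⟩
  | add x y hx hy =>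
    obtain ⟨a, rfl⟩ := hx
    obtain ⟨b, rfl⟩ := hy
    exact ⟨a + b, map_add _ _ _⟩

/-- Modulo the image of `N ⊗ M`, the class of `a ⊗ m` depends only on `f' a`. Hence any
set-theoretic section of `f'` gives a well-defined inverse `ρ` to the map that `f'` induces on this
quotient. -/
theorem map_left_exact {f : N →ₗ[Rᵐᵒᵖ] N'} {f' : N' →ₗ[Rᵐᵒᵖ] N''} (hf : Function.Exact f f')
    (hs : Function.Surjective f') (x : BalTensor R N' M)
    (hx : map f' (LinearMap.id : M →ₗ[R] M) x = 0) :
    ∃ y, map f (LinearMap.id : M →ₗ[R] M) y = x := by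
  let H := (map f (LinearMap.id : M →ₗ[R] M)).range
  have key : ∀ (a b : N') (m : M), f' a = f' b →
      (QuotientAddGroup.mk' H) (tmul R a m) = (QuotientAddGroup.mk' H) (tmul R b m) := by
    intro a b m hab
    obtain ⟨c, hc⟩ := (hf (a - b)).mp (by rw [map_sub, hab, sub_self])
    rw [← sub_eq_zero, ← map_sub]
    refine (QuotientAddGroup.eq_zero_iff _).mpr ⟨tmul R c m, ?_⟩
    rw [map_tmul, hc, LinearMap.id_apply, eq_sub_iff_add_eq, ← add_tmul, sub_add_cancel]
  let σ := Function.surjInv hs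
  have hσ : ∀ n, f' (σ n) = n := Function.surjInv_eq hs
  let ρ : BalTensor R N'' M →+ BalTensor R N' M ⧸ H :=
    lift₂ (fun n m => QuotientAddGroup.mk' H (tmul R (σ n) m))
      (fun n n' m => by
        rw [← map_add, ← add_tmul]
        exact key _ _ _ (by rw [map_add, hσ, hσ, hσ]))
      (fun n m m' => by rw [tmul_add, map_add])
      (fun n r m => by
        rw [← smul_tmul]
        exact key _ _ _ (by rw [map_smul, hσ, hσ]))
  have hρ : ∀ z, ρ (map f' (LinearMap.id : M →ₗ[R] M) z) = QuotientAddGroup.mk' H z := by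
    intro z
    induction z using induction_on with
    | zero => simp
    | tmul n m => exact key _ _ _ (hσ _)
    | add x y hx hy => simp only [map_add, hx, hy]
  have h0 := hρ x
  rw [hx, map_zero] at h0
  exact (QuotientAddGroup.eq_zero_iff _).mp h0.symm

theorem map_right_exact {g : M →ₗ[R] M'} {g' : M' →ₗ[R] M''} (hg : Function.Exact g g')
    (hs : Function.Surjective g') (x : BalTensor R N M')
    (hx : map (LinearMap.id : N →ₗ[Rᵐᵒᵖ] N) g' x = 0) :
    ∃ y, map (LinearMap.id : N →ₗ[Rᵐᵒᵖ] N) g y = x := by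
  let H := (map (LinearMap.id : N →ₗ[Rᵐᵒᵖ] N) g).range
  have key : ∀ (n : N) (a b : M'), g' a = g' b →
      (QuotientAddGroup.mk' H) (tmul R n a) = (QuotientAddGroup.mk' H) (tmul R n b) := by
    intro n a b hab
    obtain ⟨c, hc⟩ := (hg (a - b)).mp (by rw [map_sub, hab, sub_self])
    rw [← sub_eq_zero, ← map_sub]
    refine (QuotientAddGroup.eq_zero_iff _).mpr ⟨tmul R n c, ?_⟩
    rw [map_tmul, hc, LinearMap.id_apply, eq_sub_iff_add_eq, ← tmul_add, sub_add_cancel]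
  let σ := Function.surjInv hs
  have hσ : ∀ n, g' (σ n) = n := Function.surjInv_eq hs
  let ρ : BalTensor R N M'' →+ BalTensor R N M' ⧸ H :=
    lift₂ (fun n m => QuotientAddGroup.mk' H (tmul R n (σ m)))
      (fun n n' m => by rw [add_tmul, map_add])
      (fun n m m' => by
        rw [← map_add, ← tmul_add]
        exact key _ _ _ (by rw [map_add, hσ, hσ, hσ]))
      (fun n r m => by
        rw [smul_tmul]
        exact key _ _ _ (by rw [map_smul, hσ, hσ]))
  have hρ : ∀ z, ρ (map (LinearMap.id : N →ₗ[Rᵐᵒᵖ] N) g' z) = QuotientAddGroup.mk' H z := by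
    intro z
    induction z using induction_on with
    | zero => simp
    | tmul n m => exact key _ _ _ (hσ _)
    | add x y hx hy => simp only [map_add, hx, hy]
  have h0 := hρ x
  rw [hx, map_zero] at h0
  exact (QuotientAddGroup.eq_zero_iff _).mp h0.symm

end

section balance

variable {R K Q N W F V : Type*} [Ring R] [AddCommGroup K] [Module Rᵐᵒᵖ K]
  [AddCommGroup Q] [Module Rᵐᵒᵖ Q] [AddCommGroup N] [Module Rᵐᵒᵖ N] [AddCommGroup W] [Module R W]
  [AddCommGroup F] [Module R F] [AddCommGroup V] [Module R V]
  {i : K →ₗ[Rᵐᵒᵖ] Q} {p : Q →ₗ[Rᵐᵒᵖ] N} {j : W →ₗ[R] F} {q : F →ₗ[R] V}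

/-- This lemma and the next are the balance of `Tor₁(N, V)`: its vanishing can be read off from a
presentation of either argument, provided the middle term of the other presentation keeps the given
injection injective. -/
theorem injective_right_of_left (h : IsShortExact i p) (h' : IsShortExact j q)
    (hQ : Function.Injective (map (LinearMap.id : Q →ₗ[Rᵐᵒᵖ] Q) j))
    (hV : Function.Injective (map i (LinearMap.id : V →ₗ[R] V))) :
    Function.Injective (map (LinearMap.id : N →ₗ[Rᵐᵒᵖ] N) j) :=
  injective_of_three_by_three (map LinearMap.id j) (map LinearMap.id q)
    (map LinearMap.id j) (map LinearMap.id q) (map LinearMap.id j)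
    (map i LinearMap.id) (map i LinearMap.id) (map i LinearMap.id)
    (map p LinearMap.id) (map p LinearMap.id)
    (map_right_exact h'.exact h'.surj) hQ (map_right_eq_zero h'.zero) hV
    (map_surjective h.surj Function.surjective_id) (map_left_eq_zero h.zero)
    (map_left_exact h.exact h.surj) (map_comm _ _) (map_comm _ _) (map_comm _ _)

theorem injective_left_of_right (h : IsShortExact i p) (h' : IsShortExact j q)
    (hF : Function.Injective (map i (LinearMap.id : F →ₗ[R] F)))
    (hN : Function.Injective (map (LinearMap.id : N →ₗ[Rᵐᵒᵖ] N) j)) :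
    Function.Injective (map i (LinearMap.id : V →ₗ[R] V)) :=
  injective_of_three_by_three (map i LinearMap.id) (map p LinearMap.id)
    (map i LinearMap.id) (map p LinearMap.id) (map i LinearMap.id)
    (map LinearMap.id j) (map LinearMap.id j) (map LinearMap.id j)
    (map LinearMap.id q) (map LinearMap.id q)
    (map_left_exact h.exact h.surj) hF (map_left_eq_zero h.zero) hN
    (map_surjective Function.surjective_id h'.surj) (map_right_eq_zero h'.zero)
    (map_right_exact h'.exact h'.surj)
    (fun x => (map_comm _ _ x).symm) (fun x => (map_comm _ _ x).symm)
    (fun x => (map_comm _ _ x).symm)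

end balance

end BalTensor

/-! ### Flat modules, Tor and flat dimension -/

open BalTensor

/-- A section `s` of the free cover of `F` exhibits `N ⊗ F` as a retract, natural in `N`, of the
finitely supported functions `F →₀ N`, and these preserve injections. -/
theorem IsFlatLeft.of_projective {R : Type u} [Ring R] (F : Type u) [AddCommGroup F] [Module R F]
    [Module.Projective R F] : IsFlatLeft R F := by
  obtain ⟨s, hs⟩ := Module.Projective.out (R := R) (P := F)
  have key : ∀ (N : Type u) [AddCommGroup N] [Module Rᵐᵒᵖ N],
      ∃ (θ : BalTensor R N F →+ (F →₀ N)) (ρ : (F →₀ N) →+ BalTensor R N F),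
        (∀ n x y, θ (tmul R n x) y = MulOpposite.op (s x y) • n) ∧ ∀ z, ρ (θ z) = z := by
    intro N _ _
    let θ : BalTensor R N F →+ (F →₀ N) :=
      lift₂ (fun n x => (s x).mapRange (fun r => MulOpposite.op r • n) (by simp))
        (fun n n' x => by ext; simp)
        (fun n x x' => by ext; simp [add_smul])
        (fun n r x => by ext; simp [mul_smul])
    let ρ : (F →₀ N) →+ BalTensor R N F := Finsupp.liftAddHom
      (fun y => AddMonoidHom.mk' (fun n => tmul R n y) (fun n n' => add_tmul n n' y))
    refine ⟨θ, ρ, fun n x y => by simp [θ], fun z => ?_⟩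
    induction z using induction_on with
    | zero => simp
    | tmul n x =>
      have h1 : ρ (θ (tmul R n x)) = (s x).sum fun y r => tmul R n (r • y) := by
        simp only [θ, ρ, lift₂_tmul, Finsupp.liftAddHom_apply]
        rw [Finsupp.sum_mapRange_index (by simp [zero_tmul])]
        simp [smul_tmul]
      have h2 : x = (s x).sum fun y r => r • y := by
        conv_lhs => rw [← hs x]
        simp [Finsupp.linearCombination_apply]
      rw [h1]
      conv_rhs => rw [h2]
      exact (map_finsuppSum (AddMonoidHom.mk' (fun y => tmul R n y) (fun y y' => tmul_add n y y'))
        (s x) _).symm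
    | add x y hx hy => simp only [map_add, hx, hy]
  intro N N' _ _ _ _ f hf
  obtain ⟨θ, ρ, hθ, hρ⟩ := key N
  obtain ⟨θ', ρ', hθ', hρ'⟩ := key N'
  have nat : ∀ z y, θ' (map f LinearMap.id z) y = f (θ z y) := by
    intro z y
    induction z using induction_on with
    | zero => simp
    | tmul n x => simp [map_tmul, hθ, hθ']
    | add a b ha hb => simp [ha, hb]
  refine (injective_iff_map_eq_zero _).mpr fun z hz => ?_
  rw [← hρ z]
  suffices θ z = 0 by rw [this, map_zero]
  ext y
  exact hf (by rw [← nat, hz]; simp)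

theorem IsFlatRight.of_projective {R : Type u} [Ring R] (F : Type u) [AddCommGroup F]
    [Module Rᵐᵒᵖ F] [Module.Projective Rᵐᵒᵖ F] : IsFlatRight R F := by
  obtain ⟨s, hs⟩ := Module.Projective.out (R := Rᵐᵒᵖ) (P := F)
  have key : ∀ (N : Type u) [AddCommGroup N] [Module R N],
      ∃ (θ : BalTensor R F N →+ (F →₀ N)) (ρ : (F →₀ N) →+ BalTensor R F N),
        (∀ n x y, θ (tmul R x n) y = (s x y).unop • n) ∧ ∀ z, ρ (θ z) = z := by
    intro N _ _
    let θ : BalTensor R F N →+ (F →₀ N) :=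
      lift₂ (fun x n => (s x).mapRange (fun r => r.unop • n) (by simp))
        (fun x x' n => by ext; simp [add_smul])
        (fun x n n' => by ext; simp)
        (fun x r n => by ext; simp [mul_smul])
    let ρ : (F →₀ N) →+ BalTensor R F N := Finsupp.liftAddHom
      (fun y => AddMonoidHom.mk' (fun n => tmul R y n) (fun n n' => tmul_add y n n'))
    refine ⟨θ, ρ, fun n x y => by simp [θ], fun z => ?_⟩
    induction z using induction_on with
    | zero => simp
    | tmul x n =>
      have h1 : ρ (θ (tmul R x n)) = (s x).sum fun y r => tmul R (r • y) n := by
        simp only [θ, ρ, lift₂_tmul, Finsupp.liftAddHom_apply]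
        rw [Finsupp.sum_mapRange_index (by simp [tmul_zero])]
        simp [← smul_tmul]
      have h2 : x = (s x).sum fun y r => r • y := by
        conv_lhs => rw [← hs x]
        simp [Finsupp.linearCombination_apply]
      rw [h1]
      conv_rhs => rw [h2]
      exact (map_finsuppSum (AddMonoidHom.mk' (fun y => tmul R y n) (fun y y' => add_tmul y y' n))
        (s x) _).symm
    | add x y hx hy => simp only [map_add, hx, hy]
  intro N N' _ _ _ _ f hf
  obtain ⟨θ, ρ, hθ, hρ⟩ := key N
  obtain ⟨θ', ρ', hθ', hρ'⟩ := key N'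
  have nat : ∀ z y, θ' (map LinearMap.id f z) y = f (θ z y) := by
    intro z y
    induction z using induction_on with
    | zero => simp
    | tmul x n => simp [map_tmul, hθ, hθ']
    | add a b ha hb => simp [ha, hb]
  refine (injective_iff_map_eq_zero _).mpr fun z hz => ?_
  rw [← hρ z]
  suffices θ z = 0 by rw [this, map_zero]
  ext y
  exact hf (by rw [← nat, hz]; simp)

/-- The right module `N` is an `n`-th syzygy with respect to flat right modules. -/
def IsFlatSyzygy (R : Type u) [Ring R] : ℕ → ModuleCat.{u} Rᵐᵒᵖ → Prop
  | 0, _ => True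
  | n + 1, N => ∃ (Q N' : ModuleCat.{u} Rᵐᵒᵖ) (i : N →ₗ[Rᵐᵒᵖ] Q) (p : Q →ₗ[Rᵐᵒᵖ] N'),
      IsFlatRight R Q ∧ IsShortExact i p ∧ IsFlatSyzygy R n N'

/-- `Tor₁ᴿ(N, X) = 0`. -/
def TorVanishes (R N X : Type u) [Ring R] [AddCommGroup N] [Module Rᵐᵒᵖ N]
    [AddCommGroup X] [Module R X] : Prop :=
  ∀ (K Q : Type u) [AddCommGroup K] [Module Rᵐᵒᵖ K] [AddCommGroup Q] [Module Rᵐᵒᵖ Q]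
    (i : K →ₗ[Rᵐᵒᵖ] Q) (p : Q →ₗ[Rᵐᵒᵖ] N), IsShortExact i p →
    Function.Injective (map i (LinearMap.id : X →ₗ[R] X))

/-- The vanishing of `Torᴿₙ₊₁(-, X)`. -/
def TorDimLE (R : Type u) [Ring R] (n : ℕ) (X : Type u) [AddCommGroup X] [Module R X] : Prop :=
  ∀ N : ModuleCat.{u} Rᵐᵒᵖ, IsFlatSyzygy R n N → TorVanishes R N X

theorem exists_flat_cover_right (R : Type u) [Ring R] (N : Type u) [AddCommGroup N]
    [Module Rᵐᵒᵖ N] : ∃ (K Q : ModuleCat.{u} Rᵐᵒᵖ) (i : K →ₗ[Rᵐᵒᵖ] Q) (p : Q →ₗ[Rᵐᵒᵖ] N),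
      IsFlatRight R Q ∧ IsShortExact i p := by
  obtain ⟨Q, p, hQ, hp⟩ := exists_surjective_free Rᵐᵒᵖ N
  exact ⟨ModuleCat.of _ (LinearMap.ker p), Q, _, p, IsFlatRight.of_projective Q,
    IsShortExact.of_ker p hp⟩

section

variable {R : Type u} [Ring R]

/-- The definition of `TorVanishes` tests presentations of `N`. Balance along a flat cover of `N`
transfers the test to presentations of `X`. -/
theorem TorVanishes.injective {N X W F : Type u} [AddCommGroup N] [Module Rᵐᵒᵖ N]
    [AddCommGroup X] [Module R X] [AddCommGroup W] [Module R W] [AddCommGroup F] [Module R F]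
    (h : TorVanishes R N X) {j : W →ₗ[R] F} {q : F →ₗ[R] X} (hj : IsShortExact j q) :
    Function.Injective (map (LinearMap.id : N →ₗ[Rᵐᵒᵖ] N) j) := by
  obtain ⟨K, Q, i, p, hQ, hi⟩ := exists_flat_cover_right R N
  exact injective_right_of_left hi hj (hQ _ _ j hj.inj) (h _ _ i p hi)

theorem TorVanishes.of_injective {N X W F : Type u} [AddCommGroup N] [Module Rᵐᵒᵖ N]
    [AddCommGroup X] [Module R X] [AddCommGroup W] [Module R W] [AddCommGroup F] [Module R F]
    (hF : IsFlatLeft R F) {j : W →ₗ[R] F} {q : F →ₗ[R] X} (hj : IsShortExact j q)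
    (h : Function.Injective (map (LinearMap.id : N →ₗ[Rᵐᵒᵖ] N) j)) : TorVanishes R N X :=
  fun _ _ _ _ _ _ i _ hi => injective_left_of_right hi hj (hF _ _ i hi.inj) h

theorem torDimLE_zero_iff {X : Type u} [AddCommGroup X] [Module R X] :
    TorDimLE R 0 X ↔ IsFlatLeft R X := by
  constructor
  · intro h N N' _ _ _ _ f hf
    exact h (ModuleCat.of _ (N' ⧸ LinearMap.range f)) trivial N N' f _ (IsShortExact.of_mkQ f hf)
  · intro h N _ K Q _ _ _ _ i p hi
    exact h _ _ i hi.inj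

/-- Dimension shifting in both variables. For `0 → N → Q → N' → 0` and `0 → W → F → X → 0` with flat
middle terms, the two composites `N ⊗ W → Q ⊗ F` agree. So `N ⊗ W → N ⊗ F` is injective exactly when
`N ⊗ W → Q ⊗ W` is, which identifies the vanishing of `Tor₁(N, X)` with that of `Tor₁(N', W)`. -/
theorem TorDimLE.succ_iff {n : ℕ} {X W F : Type u} [AddCommGroup X] [Module R X]
    [AddCommGroup W] [Module R W] [AddCommGroup F] [Module R F] (hF : IsFlatLeft R F)
    {j : W →ₗ[R] F} {q : F →ₗ[R] X} (hj : IsShortExact j q) :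
    TorDimLE R (n + 1) X ↔ TorDimLE R n W := by
  constructor
  · intro h N' hN'
    obtain ⟨N, Q, i, p, hQ, hi⟩ := exists_flat_cover_right R N'
    have hNX : TorVanishes R N X := h N ⟨Q, ModuleCat.of _ N', i, p, hQ, hi, hN'⟩
    obtain ⟨F₁, q₁, hF₁, hq₁⟩ := exists_surjective_free R W
    refine TorVanishes.of_injective (IsFlatLeft.of_projective F₁) (IsShortExact.of_ker q₁ hq₁) ?_
    refine injective_right_of_left hi (IsShortExact.of_ker q₁ hq₁)
      (hQ _ _ _ Subtype.val_injective) ?_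
    have h1 := (hF _ _ i hi.inj).comp (hNX.injective hj)
    intro x y hxy
    apply h1
    simp only [Function.comp_apply, map_comm, hxy]
  · rintro h N ⟨Q, N', i, p, hQ, hi, hN'⟩
    refine TorVanishes.of_injective hF hj ?_
    have h1 := (hQ _ _ j hj.inj).comp (h N' hN' _ _ i p hi)
    intro x y hxy
    apply h1
    simp only [Function.comp_apply, ← map_comm, hxy]

/-- `FlatDimLELeft` asserts that some resolution exists, while `TorDimLE` involves no choice.
Closure under retracts and products is proved on the second side. -/
theorem flatDimLELeft_iff_torDimLE {n : ℕ} : ∀ {X : Type u} [AddCommGroup X] [Module R X],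
    FlatDimLELeft R n X ↔ TorDimLE R n X := by
  induction n with
  | zero => exact fun {X} _ _ => torDimLE_zero_iff.symm
  | succ n ih =>
    intro X _ _
    constructor
    · rintro ⟨F, p, hF, hp, h⟩
      exact (TorDimLE.succ_iff hF (IsShortExact.of_ker p hp)).mpr (ih.mp h)
    · intro h
      obtain ⟨F, p, hF, hp⟩ := exists_surjective_free R X
      have hF := IsFlatLeft.of_projective (R := R) F
      exact ⟨F, p, hF, hp, ih.mpr ((TorDimLE.succ_iff hF (IsShortExact.of_ker p hp)).mp h)⟩

theorem TorDimLE.of_retract {n : ℕ} {X Y : Type u} [AddCommGroup X] [Module R X]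
    [AddCommGroup Y] [Module R Y] (h : TorDimLE R n Y) (i : X →ₗ[R] Y) (r : Y →ₗ[R] X)
    (hri : r ∘ₗ i = LinearMap.id) : TorDimLE R n X := by
  intro N hN K Q _ _ _ _ k p hk
  refine (injective_iff_map_eq_zero _).mpr fun z hz => ?_
  have h1 : map (LinearMap.id : K →ₗ[Rᵐᵒᵖ] K) i z = 0 := by
    refine (injective_iff_map_eq_zero _).mp (h N hN _ _ k p hk) _ ?_
    rw [map_comm, hz, map_zero]
  have h2 := map_map (LinearMap.id : K →ₗ[Rᵐᵒᵖ] K) i LinearMap.id r z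
  rw [h1, map_zero, hri, LinearMap.id_comp, map_id_id] at h2
  exact h2.symm

theorem TorDimLE.prod {n : ℕ} {X Y : Type u} [AddCommGroup X] [Module R X]
    [AddCommGroup Y] [Module R Y] (hX : TorDimLE R n X) (hY : TorDimLE R n Y) :
    TorDimLE R n (X × Y) := by
  intro N hN K Q _ _ _ _ k p hk
  refine (injective_iff_map_eq_zero _).mpr fun z hz => ?_
  have h1 : map (LinearMap.id : K →ₗ[Rᵐᵒᵖ] K) (LinearMap.fst R X Y) z = 0 := by
    refine (injective_iff_map_eq_zero _).mp (hX N hN _ _ k p hk) _ ?_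
    rw [map_comm, hz, map_zero]
  have h2 : map (LinearMap.id : K →ₗ[Rᵐᵒᵖ] K) (LinearMap.snd R X Y) z = 0 := by
    refine (injective_iff_map_eq_zero _).mp (hY N hN _ _ k p hk) _ ?_
    rw [map_comm, hz, map_zero]
  have h3 : ∀ w : BalTensor R K (X × Y),
      map (LinearMap.id : K →ₗ[Rᵐᵒᵖ] K) (LinearMap.inl R X Y)
        (map (LinearMap.id : K →ₗ[Rᵐᵒᵖ] K) (LinearMap.fst R X Y) w) +
      map (LinearMap.id : K →ₗ[Rᵐᵒᵖ] K) (LinearMap.inr R X Y)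
        (map (LinearMap.id : K →ₗ[Rᵐᵒᵖ] K) (LinearMap.snd R X Y) w) = w := by
    intro w
    induction w using induction_on with
    | zero => simp
    | tmul n m => simp [map_tmul, ← tmul_add]
    | add a b ha hb =>
      simp only [map_add]
      rw [add_add_add_comm, ha, hb]
  rw [← h3 z, h1, h2, map_zero, map_zero, add_zero]

theorem TorDimLE.mono_zero {n : ℕ} {X : Type u} [AddCommGroup X] [Module R X]
    (h : IsFlatLeft R X) : TorDimLE R n X :=
  fun _ _ _ _ _ _ _ _ i _ hi => h _ _ i hi.inj

theorem FlatDimLELeft.of_retract {n : ℕ} {X Y : Type u} [AddCommGroup X] [Module R X]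
    [AddCommGroup Y] [Module R Y] (h : FlatDimLELeft R n Y) (i : X →ₗ[R] Y) (r : Y →ₗ[R] X)
    (hri : ∀ x, r (i x) = x) : FlatDimLELeft R n X :=
  flatDimLELeft_iff_torDimLE.mpr
    ((flatDimLELeft_iff_torDimLE.mp h).of_retract i r (LinearMap.ext hri))

theorem FlatDimLELeft.prod_flat {n : ℕ} {X Y : Type u} [AddCommGroup X] [Module R X]
    [AddCommGroup Y] [Module R Y] (h : FlatDimLELeft R n X) (hY : IsFlatLeft R Y) :
    FlatDimLELeft R n (X × Y) :=
  flatDimLELeft_iff_torDimLE.mpr ((flatDimLELeft_iff_torDimLE.mp h).prod (.mono_zero hY))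

theorem IsFlatLeft.of_retract {X Y : Type u} [AddCommGroup X] [Module R X]
    [AddCommGroup Y] [Module R Y] (h : IsFlatLeft R Y) (i : X →ₗ[R] Y) (r : Y →ₗ[R] X)
    (hri : ∀ x, r (i x) = x) : IsFlatLeft R X :=
  FlatDimLELeft.of_retract (n := 0) h i r hri

end

/-! ### Associativity, and flat dimension of a tensor product -/

namespace BalTensor

section rightModule

variable {S R K V : Type*} [Ring S] [Ring R] [AddCommGroup K] [Module Sᵐᵒᵖ K]
  [AddCommGroup V] [Module S V] [Module Rᵐᵒᵖ V] [SMulCommClass S Rᵐᵒᵖ V]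

/-- For an `(S, R)`-bimodule `V`, the action of `R` on `K ⊗_S V` through the right factor. -/
def rightSMul (r : Rᵐᵒᵖ) : BalTensor S K V →+ BalTensor S K V :=
  map LinearMap.id
    { toFun := fun v => r • v
      map_add' := smul_add r
      map_smul' := fun s v => (smul_comm s r v).symm }

variable (S R K V) in
/-- For an `(S, R)`-bimodule `V`, the group `K ⊗_S V` is a right `R`-module. -/
@[reducible] def rightModule : Module Rᵐᵒᵖ (BalTensor S K V) where
  smul r := rightSMul r
  smul_zero r := map_zero (rightSMul r)
  smul_add r := map_add (rightSMul r)
  one_smul x := by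
    change rightSMul 1 x = x
    induction x using induction_on with
    | zero => exact map_zero _
    | tmul n m => simp [rightSMul, map_tmul]
    | add x y hx hy => rw [map_add, hx, hy]
  mul_smul r t x := by
    change rightSMul (r * t) x = rightSMul r (rightSMul t x)
    induction x using induction_on with
    | zero => simp
    | tmul n m => simp [rightSMul, map_tmul, mul_smul]
    | add x y hx hy => simp only [map_add, hx, hy]
  add_smul r t x := by
    change rightSMul (r + t) x = rightSMul r x + rightSMul t x
    induction x using induction_on with
    | zero => simp
    | tmul n m => simp [rightSMul, map_tmul, add_smul, tmul_add]
    | add x y hx hy => rw [map_add, hx, hy, map_add, map_add]; abel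
  zero_smul x := by
    change rightSMul 0 x = 0
    induction x using induction_on with
    | zero => simp
    | tmul n m => simp [rightSMul, map_tmul, tmul_zero]
    | add x y hx hy => simp only [map_add, hx, hy, add_zero]

end rightModule

end BalTensor

section

variable {S R : Type u} [Ring S] [Ring R] {V : Type u} [AddCommGroup V] [Module S V]
  [Module Rᵐᵒᵖ V] [SMulCommClass S Rᵐᵒᵖ V]

/-- Only half of the associativity isomorphism is recorded: injectivity of `θ` and its formula on
pure tensors are all that is needed below. -/
theorem exists_assoc_retraction (K F : Type u) [AddCommGroup K] [Module Sᵐᵒᵖ K]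
    [AddCommGroup F] [Module R F] :
    letI := rightModule S R K V
    ∃ (θ : BalTensor S K (BalTensor R V F) →+ BalTensor R (BalTensor S K V) F)
      (ρ : BalTensor R (BalTensor S K V) F →+ BalTensor S K (BalTensor R V F)),
      (∀ k v x, θ (tmul S k (tmul R v x)) = tmul R (tmul S k v) x) ∧ ∀ z, ρ (θ z) = z := by
  let := rightModule S R K V
  have hsm : ∀ (r : R) (k : K) (v : V),
      MulOpposite.op r • tmul S k v = tmul S k (MulOpposite.op r • v) := fun r k v => rfl
  let θ₁ : K → BalTensor R V F →+ BalTensor R (BalTensor S K V) F := fun k =>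
    lift₂ (fun v x => tmul R (tmul S k v) x) (fun v v' x => by rw [tmul_add, add_tmul])
      (fun v x x' => tmul_add _ _ _) (fun v r x => by rw [← hsm, smul_tmul])
  let θ : BalTensor S K (BalTensor R V F) →+ BalTensor R (BalTensor S K V) F :=
    lift₂ (fun k y => θ₁ k y)
      (fun k k' y => by
        induction y using induction_on with
        | zero => simp
        | tmul v x => simp [θ₁, add_tmul]
        | add y y' hy hy' => simp only [map_add, hy, hy']; abel)
      (fun k y y' => map_add _ _ _)
      (fun k s y => by
        induction y using induction_on with
        | zero => simp
        | tmul v x => simp [θ₁, smul_tmul_left, smul_tmul]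
        | add y y' hy hy' => simp only [smul_add, map_add, hy, hy'])
  let ρ₁ : F → BalTensor S K V →+ BalTensor S K (BalTensor R V F) := fun x =>
    lift₂ (fun k v => tmul S k (tmul R v x)) (fun k k' v => by rw [add_tmul])
      (fun k v v' => by rw [add_tmul, tmul_add])
      (fun k s v => by rw [smul_tmul, smul_tmul_left])
  let ρ : BalTensor R (BalTensor S K V) F →+ BalTensor S K (BalTensor R V F) :=
    lift₂ (fun y x => ρ₁ x y) (fun y y' x => map_add _ _ _)
      (fun y x x' => by
        induction y using induction_on with
        | zero => simp
        | tmul k v => simp [ρ₁, tmul_add]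
        | add y y' hy hy' => simp only [map_add, hy, hy']; abel)
      (fun y r x => by
        induction y using induction_on with
        | zero => simp
        | tmul k v => simp [ρ₁, hsm, smul_tmul]
        | add y y' hy hy' => simp only [smul_add, map_add, hy, hy'])
  refine ⟨θ, ρ, fun k v x => rfl, fun z => ?_⟩
  induction z using induction_on with
  | zero => simp
  | tmul k y =>
    induction y using induction_on with
    | zero => simp [tmul_zero]
    | tmul v x => rfl
    | add y y' hy hy' => rw [tmul_add, map_add, map_add, hy, hy']
  | add y y' hy hy' => rw [map_add, map_add, hy, hy']

/-- Up to associativity, `i ⊗ (V ⊗ F)` is `(i ⊗ V) ⊗ F`. The map `i ⊗ V` is injective by the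
hypothesis on `V`, and it is `R`-linear on the right, so flatness of `F` applies. -/
theorem TorDimLE.balTensor {n : ℕ} (hV : TorDimLE S n V) {F : Type u} [AddCommGroup F]
    [Module R F] (hF : IsFlatLeft R F) : TorDimLE S n (BalTensor R V F) := by
  intro N hN K Q _ _ _ _ i p hi
  let := rightModule S R K V
  let := rightModule S R Q V
  obtain ⟨θ, ρ, hθ, hρ⟩ := exists_assoc_retraction (S := S) (R := R) (V := V) K F
  obtain ⟨θ', ρ', hθ', hρ'⟩ := exists_assoc_retraction (S := S) (R := R) (V := V) Q F
  let iV : BalTensor S K V →ₗ[Rᵐᵒᵖ] BalTensor S Q V :=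
    { toFun := map i LinearMap.id
      map_add' := map_add _
      map_smul' := fun r x => map_comm i _ x }
  have hiV : Function.Injective iV := hV N hN K Q i p hi
  have nat : ∀ z, θ' (map i LinearMap.id z) = map iV LinearMap.id (θ z) := by
    intro z
    induction z using induction_on with
    | zero => simp
    | tmul k y =>
      induction y using induction_on with
      | zero => simp [tmul_zero]
      | tmul v x => simp only [map_tmul, hθ, LinearMap.id_apply, hθ']; rfl
      | add y y' hy hy' => simp only [tmul_add, map_add, hy, hy']
    | add y y' hy hy' => simp only [map_add, hy, hy']
  refine (injective_iff_map_eq_zero _).mpr fun z hz => ?_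
  rw [← hρ z]
  suffices θ z = 0 by rw [this, map_zero]
  refine (injective_iff_map_eq_zero _).mp (hF _ _ iV hiV) _ ?_
  rw [← nat, hz, map_zero]

/-- If the `(S, R)`-bimodule `V` has flat dimension at most `n` as a left `S`-module and `F` is
flat, then `V ⊗_R F` has flat dimension at most `n`. -/
theorem FlatDimLELeft.balTensor {n : ℕ} (hV : FlatDimLELeft S n V) {F : Type u} [AddCommGroup F]
    [Module R F] (hF : IsFlatLeft R F) : FlatDimLELeft S n (BalTensor R V F) :=
  flatDimLELeft_iff_torDimLE.mpr ((flatDimLELeft_iff_torDimLE.mp hV).balTensor hF)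

end

/-! ### Factoring linear maps, and vanishing of Ext¹ -/

section

variable {R : Type u} [Ring R]

theorem exists_desc {X Y Z : Type*} [AddCommGroup X] [Module R X] [AddCommGroup Y] [Module R Y]
    [AddCommGroup Z] [Module R Z] (s : X →ₗ[R] Y) (hs : Function.Surjective s) (t : X →ₗ[R] Z)
    (h : ∀ x, s x = 0 → t x = 0) : ∃ g : Y →ₗ[R] Z, ∀ x, g (s x) = t x := by
  refine ⟨(LinearMap.ker s).liftQ t h ∘ₗ (s.quotKerEquivOfSurjective hs).symm.toLinearMap,
    fun x => ?_⟩
  have : (s.quotKerEquivOfSurjective hs).symm (s x) = (LinearMap.ker s).mkQ x := by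
    rw [LinearEquiv.symm_apply_eq]; rfl
  simp only [LinearMap.comp_apply, LinearEquiv.coe_coe, this]
  exact Submodule.liftQ_apply _ _ _

theorem exists_lift {X Y Z : Type*} [AddCommGroup X] [Module R X] [AddCommGroup Y] [Module R Y]
    [AddCommGroup Z] [Module R Z] (i : X →ₗ[R] Y) (hi : Function.Injective i) (t : Z →ₗ[R] Y)
    (h : ∀ z, ∃ x, i x = t z) : ∃ g : Z →ₗ[R] X, ∀ z, i (g z) = t z := by
  choose g hg using h
  exact ⟨{ toFun := g
           map_add' := fun a b => hi (by simp [hg])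
           map_smul' := fun r a => hi (by simp [hg]) }, hg⟩

/-- `Ext¹_R(G, F) = 0`: maps into `F` extend along monomorphisms with cokernel `G`. -/
def ExtVanishes (R : Type u) [Ring R] (G F : Type u) [AddCommGroup G] [Module R G]
    [AddCommGroup F] [Module R F] : Prop :=
  ∀ (X Y : Type u) [AddCommGroup X] [Module R X] [AddCommGroup Y] [Module R Y]
    (i : X →ₗ[R] Y) (p : Y →ₗ[R] G), IsShortExact i p →
    ∀ f : X →ₗ[R] F, ∃ g : Y →ₗ[R] F, ∀ x, g (i x) = f x

section Ext

variable {F G G' G'' : Type u} [AddCommGroup F] [Module R F] [AddCommGroup G] [Module R G]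
  [AddCommGroup G'] [Module R G'] [AddCommGroup G''] [Module R G'']

/-- One projective presentation of `G` suffices: any extension of `G` by `X` is the pushout of it
along a map `l : K → X`, so `f` on `X` and an extension of `f ∘ l` to `P` glue. -/
theorem ExtVanishes.of_projective {K P : Type u} [AddCommGroup K] [Module R K] [AddCommGroup P]
    [Module R P] [Module.Projective R P] {j : K →ₗ[R] P} {q : P →ₗ[R] G} (hj : IsShortExact j q)
    (h : ∀ f : K →ₗ[R] F, ∃ g : P →ₗ[R] F, ∀ x, g (j x) = f x) : ExtVanishes R G F := by
  intro X Y _ _ _ _ i p hi f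
  obtain ⟨a, ha⟩ := Module.projective_lifting_property p q hi.surj
  replace ha : ∀ x, p (a x) = q x := fun x => LinearMap.congr_fun ha x
  obtain ⟨l, hl⟩ := exists_lift i hi.inj (a ∘ₗ j) fun z =>
    (hi.exact _).mp (by simp [ha, hj.zero])
  obtain ⟨g, hg⟩ := h (f ∘ₗ l)
  -- `X × P → Y` is onto and its kernel consists of the pairs `(-l z, j z)`, on which `f` and `g`
  -- cancel.
  obtain ⟨k, hk⟩ := exists_desc (i.coprod a) (by
      intro y
      obtain ⟨x, hx⟩ := hj.surj (p y)
      obtain ⟨z, hz⟩ := (hi.exact (y - a x)).mp (by simp [ha, hx])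
      exact ⟨(z, x), by simp [hz]⟩) (f.coprod g) (by
      rintro ⟨x, y⟩ hxy
      simp only [LinearMap.coprod_apply] at hxy ⊢
      obtain ⟨z, rfl⟩ := (hj.exact y).mp (by
        rw [← ha, eq_neg_of_add_eq_zero_right hxy]
        simp [hi.zero])
      have : x = - l z := hi.inj (by
        rw [map_neg, hl]; exact eq_neg_of_add_eq_zero_left hxy)
      simp [hg, this])
  exact ⟨k, fun x => by simpa using hk (x, 0)⟩

theorem ExtVanishes.of_iso {F' : Type u} [AddCommGroup F'] [Module R F'] (h : ExtVanishes R G F)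
    (e : F ≃ₗ[R] F') : ExtVanishes R G F' := by
  intro X Y _ _ _ _ i p hi f
  obtain ⟨g, hg⟩ := h X Y i p hi (e.symm.toLinearMap ∘ₗ f)
  exact ⟨e.toLinearMap ∘ₗ g, fun x => by simp [hg]⟩

/-- The preimage `Y'` of `G'` in `Y` splits the problem: extend first from `X` to `Y'`, with
quotient `G'`, then from `Y'` to `Y`, with quotient `G''`. -/
theorem ExtVanishes.extension {a : G' →ₗ[R] G} {b : G →ₗ[R] G''} (hab : IsShortExact a b)
    (h' : ExtVanishes R G' F) (h'' : ExtVanishes R G'' F) : ExtVanishes R G F := by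
  intro X Y _ _ _ _ i p hi f
  let Y' := LinearMap.ker (b ∘ₗ p)
  have hY' : ∀ y : Y', b (p y) = 0 := fun y => y.2
  obtain ⟨i', hi'⟩ := exists_lift Y'.subtype Subtype.val_injective i fun x =>
    ⟨⟨i x, by simp [Y', hi.zero]⟩, rfl⟩
  obtain ⟨p', hp'⟩ := exists_lift a hab.inj (p ∘ₗ Y'.subtype) fun y => (hab.exact _).mp (hY' y)
  have h1 : IsShortExact i' p' := by
    refine ⟨fun x y hxy => hi.inj (by rw [← hi', ← hi', hxy]), fun y => ⟨fun hy => ?_, ?_⟩,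
      fun g => ?_⟩
    · obtain ⟨x, hx⟩ := (hi.exact y).mp (by
        have := hp' y
        rw [hy, map_zero] at this
        exact this.symm)
      exact ⟨x, Subtype.ext ((hi' x).trans hx)⟩
    · rintro ⟨x, rfl⟩
      exact hab.inj (by rw [hp']; simp only [LinearMap.comp_apply, hi', hi.zero, map_zero])
    · obtain ⟨y, hy⟩ := hi.surj (a g)
      exact ⟨⟨y, by simp [Y', hy, hab.zero]⟩, hab.inj (by rw [hp']; exact hy)⟩
  obtain ⟨g, hg⟩ := h' X Y' i' p' h1 f
  obtain ⟨k, hk⟩ := h'' Y' Y Y'.subtype (b ∘ₗ p)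
    (IsShortExact.of_ker _ (hab.surj.comp hi.surj)) g
  exact ⟨k, fun x => by rw [← hi', hk, hg]⟩

/-- The pullback of `q` along `f` is an extension of `G` by `K`, so it splits; following the
splitting by the projection to `F₀` gives the lift. -/
theorem ExtVanishes.exists_lift_map {K F₀ : Type u} [AddCommGroup K] [Module R K]
    [AddCommGroup F₀] [Module R F₀] {j : K →ₗ[R] F₀} {q : F₀ →ₗ[R] F} (hj : IsShortExact j q)
    (h : ExtVanishes R G K) (f : G →ₗ[R] F) : ∃ g : G →ₗ[R] F₀, ∀ x, q (g x) = f x := by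
  let Y := LinearMap.eqLocus (f ∘ₗ LinearMap.fst R G F₀) (q ∘ₗ LinearMap.snd R G F₀)
  have hY : ∀ y : Y, f y.1.1 = q y.1.2 := fun y => y.2
  obtain ⟨i, hi⟩ := exists_lift Y.subtype Subtype.val_injective (LinearMap.inr R G F₀ ∘ₗ j)
    fun x => ⟨⟨(0, j x), by simp [Y, hj.zero]⟩, rfl⟩
  have h1 : IsShortExact i (LinearMap.fst R G F₀ ∘ₗ Y.subtype) := by
    refine ⟨fun x y hxy => hj.inj ?_, fun y => ⟨fun hy => ?_, ?_⟩, fun g => ?_⟩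
    · have := congrArg Y.subtype hxy
      rw [hi, hi] at this
      exact (Prod.ext_iff.mp this).2
    · have hy : y.1.1 = 0 := hy
      obtain ⟨x, hx⟩ := (hj.exact y.1.2).mp (by rw [← hY, hy, map_zero])
      exact ⟨x, Subtype.ext ((hi x).trans (Prod.ext hy.symm hx))⟩
    · rintro ⟨x, rfl⟩
      rw [LinearMap.comp_apply, hi]
      rfl
    · obtain ⟨x, hx⟩ := hj.surj (f g)
      exact ⟨⟨(g, x), hx.symm⟩, rfl⟩
  obtain ⟨r, hr⟩ := h K Y i _ h1 LinearMap.id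
  obtain ⟨s, hs⟩ := exists_desc (LinearMap.fst R G F₀ ∘ₗ Y.subtype) h1.surj
    (LinearMap.snd R G F₀ ∘ₗ Y.subtype - j ∘ₗ r) (by
      intro y hy
      obtain ⟨x, rfl⟩ := (h1.exact y).mp hy
      have : (Y.subtype (i x)).2 = j x := by rw [hi]; rfl
      simp only [LinearMap.sub_apply, LinearMap.comp_apply, LinearMap.snd_apply, this, hr]
      simp)
  refine ⟨s, fun x => ?_⟩
  obtain ⟨y, rfl⟩ := h1.surj x
  rw [hs]
  simp only [LinearMap.sub_apply, LinearMap.comp_apply, LinearMap.snd_apply, map_sub, hj.zero,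
    sub_zero]
  exact (hY y).symm

end Ext

/-! ### Ding classes and Ding projective modules -/

/-- A class of modules closed under taking suitable syzygies and cosyzygies, whose members have
no extensions by flat modules. -/
structure IsDingClass (R : Type u) [Ring R] (𝒢 : ModuleCat.{u} R → Prop) : Prop where
  syz : ∀ G, 𝒢 G → ∃ (K P : ModuleCat.{u} R) (i : K →ₗ[R] P) (p : P →ₗ[R] G),
    Module.Projective R P ∧ IsShortExact i p ∧ 𝒢 K
  cosyz : ∀ G, 𝒢 G → ∃ (P K : ModuleCat.{u} R) (i : G →ₗ[R] P) (p : P →ₗ[R] K),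
    Module.Projective R P ∧ IsShortExact i p ∧ 𝒢 K
  ext : ∀ G, 𝒢 G → ∀ (F : Type u) [AddCommGroup F] [Module R F], IsFlatLeft R F →
    ExtVanishes R G F

theorem exists_int_chain {α : Type*} (r : α → α → Prop) (h₁ : ∀ a, ∃ b, r a b)
    (h₂ : ∀ a, ∃ b, r b a) (a : α) : ∃ Z : ℤ → α, Z 0 = a ∧ ∀ i, r (Z i) (Z (i + 1)) := by
  choose f hf using h₁
  choose g hg using h₂
  -- `Int.negSucc n` is `-(n + 1)`, hence the `n + 1` backward iterates.
  refine ⟨fun i => Int.rec (fun n => f^[n] a) (fun n => g^[n + 1] a) i, rfl, fun i => ?_⟩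
  rcases i with n | n
  · change r (f^[n] a) (f^[n + 1] a)
    rw [Function.iterate_succ_apply']
    exact hf _
  · rcases n with _ | n
    · exact hg a
    · have : Int.negSucc (n + 1) + 1 = Int.negSucc n := by omega
      rw [this]
      change r (g^[n + 1 + 1] a) (g^[n + 1] a)
      rw [Function.iterate_succ_apply' g (n + 1)]
      exact hg _

theorem IsDingProjective.of_equiv {M N : Type u} [AddCommGroup M] [Module R M] [AddCommGroup N]
    [Module R N] (h : IsDingProjective R M) (e : M ≃ₗ[R] N) : IsDingProjective R N := by
  obtain ⟨P, d, hP, hd, hF, ⟨e'⟩⟩ := h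
  exact ⟨P, d, hP, hd, hF, ⟨e.symm.trans e'⟩⟩

/-- Syzygies and cosyzygies chosen inside the class give sequences `0 → Z i → P i → Z (i + 1) → 0`
for all integers `i`; splicing them gives the complex. It stays exact under `Hom(-, F)` because
`Ext¹(Z i, F) = 0` for every `i`. -/
theorem IsDingClass.isDingProjective {𝒢 : ModuleCat.{u} R → Prop} (h𝒢 : IsDingClass R 𝒢)
    (M : Type u) [AddCommGroup M] [Module R M] (hM : 𝒢 (ModuleCat.of R M)) :
    IsDingProjective R M := by
  let r : {G // 𝒢 G} → {G // 𝒢 G} → Prop := fun G K =>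
    ∃ (P : ModuleCat.{u} R) (i : G.1 →ₗ[R] P) (p : P →ₗ[R] K.1),
      Module.Projective R P ∧ IsShortExact i p
  obtain ⟨Z, hZ, hr⟩ := exists_int_chain r
    (fun G => by
      obtain ⟨P, K, i, p, hP, hi, hK⟩ := h𝒢.cosyz G.1 G.2
      exact ⟨⟨K, hK⟩, P, i, p, hP, hi⟩)
    (fun G => by
      obtain ⟨K, P, i, p, hP, hi, hK⟩ := h𝒢.syz G.1 G.2
      exact ⟨⟨K, hK⟩, P, i, p, hP, hi⟩) ⟨_, hM⟩
  choose P ι π hP hS using hr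
  refine ⟨P, fun i => ι (i + 1) ∘ₗ π i, hP, fun i x => ⟨fun hx => ?_, ?_⟩, ?_, ⟨?_⟩⟩
  · have hx : ι (i + 1 + 1) (π (i + 1) x) = 0 := hx
    obtain ⟨y, rfl⟩ := ((hS (i + 1)).exact x).mp ((hS (i + 1 + 1)).inj (by rw [hx, map_zero]))
    obtain ⟨y, rfl⟩ := (hS i).surj y
    exact ⟨y, rfl⟩
  · rintro ⟨y, rfl⟩
    simp [(hS (i + 1)).zero]
  · intro F _ _ hF i g
    constructor
    · intro hg
      have hg : ∀ x, g (ι (i + 1) (π i x)) = 0 := fun x => LinearMap.congr_fun hg x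
      obtain ⟨k, hk⟩ := exists_desc (π (i + 1)) (hS (i + 1)).surj g (by
        intro x hx
        obtain ⟨y, rfl⟩ := ((hS (i + 1)).exact x).mp hx
        obtain ⟨y, rfl⟩ := (hS i).surj y
        exact hg y)
      obtain ⟨l, hl⟩ := h𝒢.ext _ (Z (i + 1 + 1 + 1)).2 F hF _ _ _ _ (hS (i + 1 + 1)) k
      exact ⟨l, LinearMap.ext fun x => (hl _).trans (hk x)⟩
    · rintro ⟨k, rfl⟩
      ext x
      simp [(hS (i + 1)).zero]
  · have hk : LinearMap.ker (ι (0 + 1) ∘ₗ π 0) = LinearMap.range (ι 0) := by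
      rw [LinearMap.ker_comp_of_ker_eq_bot _ (LinearMap.ker_eq_bot.mpr (hS (0 + 1)).inj)]
      exact (LinearMap.exact_iff.mp (hS 0).exact)
    -- `hZ` is an equality of bundled modules; substituting it turns it into an isomorphism.
    have e : ∀ G : {G // 𝒢 G}, G = ⟨ModuleCat.of R M, hM⟩ → Nonempty (M ≃ₗ[R] G.1) := by
      rintro G rfl
      exact ⟨LinearEquiv.refl R M⟩
    exact (e _ hZ).some.trans
      ((LinearEquiv.ofInjective (ι 0) (hS 0).inj).trans (LinearEquiv.ofEq _ _ hk.symm))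

/-- All the kernels in one complete complex form a Ding class. By the previous criterion its members
are Ding projective, so the union over all complexes is again a Ding class. -/
theorem isDingClass_isDingProjective :
    IsDingClass R fun G : ModuleCat.{u} R => IsDingProjective R G := by
  have key : ∀ (P : ℤ → ModuleCat.{u} R) (d : ∀ i : ℤ, P i →ₗ[R] P (i + 1)),
    (∀ i, Module.Projective R (P i)) →
    (∀ i, Function.Exact (d i) (d (i + 1))) →
    (∀ (F : Type u) [AddCommGroup F] [Module R F], IsFlatLeft R F →
      ∀ i, Function.Exact
        (fun g : P (i + 1 + 1) →ₗ[R] F => g ∘ₗ d (i + 1))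
        (fun g : P (i + 1) →ₗ[R] F => g ∘ₗ d i)) →
    IsDingClass R fun G : ModuleCat.{u} R => ∃ i, Nonempty (G ≃ₗ[R] LinearMap.ker (d i)) := by
    intro P d hP hd hF
    have hs : ∀ i, ∃ p : P i →ₗ[R] LinearMap.ker (d (i + 1)), (∀ x, (p x).1 = d i x) ∧
        IsShortExact (LinearMap.ker (d i)).subtype p := by
      intro i
      let p := (d i).codRestrict (LinearMap.ker (d (i + 1)))
        (fun x => (hd i).apply_apply_eq_zero x)
      refine ⟨p, fun x => rfl, ?_⟩
      have : LinearMap.ker (d i) = LinearMap.ker p := (LinearMap.ker_codRestrict _ _ _).symm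
      rw [this]
      refine IsShortExact.of_ker p ?_
      rintro ⟨y, hy⟩
      obtain ⟨x, rfl⟩ := (hd i y).mp hy
      exact ⟨x, rfl⟩
    have hse : ∀ (G : ModuleCat.{u} R) (i : ℤ) (e : G ≃ₗ[R] LinearMap.ker (d (i + 1))),
        ∃ p : P i →ₗ[R] G, (∀ x, (e (p x)).1 = d i x) ∧
        IsShortExact (LinearMap.ker (d i)).subtype p := by
      intro G i e
      obtain ⟨p, hp, hi⟩ := hs i
      refine ⟨e.symm.toLinearMap ∘ₗ p, fun x => by simp [hp], hi.inj, fun x => ?_,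
        e.symm.surjective.comp hi.surj⟩
      simpa using hi.exact x
    have hpred : ∀ i : ℤ, ∃ j, i = j + 1 := fun i => ⟨i - 1, by ring⟩
    refine ⟨?_, ?_, ?_⟩
    · rintro G ⟨i, ⟨e⟩⟩
      obtain ⟨j, rfl⟩ := hpred i
      obtain ⟨p, -, hp⟩ := hse G j e
      exact ⟨ModuleCat.of R (LinearMap.ker (d j)), P j, _, p, hP j, hp, j, ⟨LinearEquiv.refl R _⟩⟩
    · rintro G ⟨i, ⟨e⟩⟩
      obtain ⟨p, -, hp⟩ := hs i
      refine ⟨P i, ModuleCat.of R (LinearMap.ker (d (i + 1))),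
        (LinearMap.ker (d i)).subtype ∘ₗ e.toLinearMap, p, hP i,
        ⟨hp.inj.comp e.injective, fun x => ?_, hp.surj⟩, i + 1, ⟨LinearEquiv.refl R _⟩⟩
      rw [hp.exact x]
      constructor
      · rintro ⟨y, rfl⟩
        exact ⟨e.symm y, by simp⟩
      · rintro ⟨y, rfl⟩
        exact ⟨e y, rfl⟩
    · rintro G ⟨i, ⟨e⟩⟩ F _ _ hFF
      -- Writing `i` as `l + 3` avoids casts: `f` is defined on the kernel of `d (l + 2)`, its
      -- pullback to `P (l + 1)` kills the image of `d l`, and Hom-exactness there extends it to `P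
      -- (l + 2)`.
      obtain ⟨j, rfl⟩ := hpred i
      obtain ⟨k, rfl⟩ := hpred j
      obtain ⟨l, rfl⟩ := hpred k
      obtain ⟨p, -, hp⟩ := hse G (l + 1 + 1) e
      have := hP (l + 1 + 1)
      refine ExtVanishes.of_projective hp fun f => ?_
      obtain ⟨q, hq, hq'⟩ := hs (l + 1)
      obtain ⟨g, hg⟩ := (hF F hFF l (f ∘ₗ q)).mp (by
        ext x
        change f (q (d l x)) = 0
        rw [show q (d l x) = 0 from Subtype.ext (by
          rw [hq]; exact (hd l).apply_apply_eq_zero x), map_zero])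
      refine ⟨g, fun x => ?_⟩
      obtain ⟨y, rfl⟩ := hq'.surj x
      exact (congrArg g (hq y)).trans (LinearMap.congr_fun hg y)
  have hD : ∀ G : ModuleCat.{u} R, IsDingProjective R G →
      ∃ 𝒢 : ModuleCat.{u} R → Prop, IsDingClass R 𝒢 ∧ 𝒢 G := by
    rintro G ⟨P, d, hP, hd, hF, e⟩
    exact ⟨_, key P d hP hd hF, 0, e⟩
  refine ⟨fun G hG => ?_, fun G hG => ?_, fun G hG => ?_⟩
  · obtain ⟨𝒢, h𝒢, hG⟩ := hD G hG
    obtain ⟨K, P, i, p, hP, hi, hK⟩ := h𝒢.syz G hG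
    exact ⟨K, P, i, p, hP, hi, h𝒢.isDingProjective K hK⟩
  · obtain ⟨𝒢, h𝒢, hG⟩ := hD G hG
    obtain ⟨P, K, i, p, hP, hi, hK⟩ := h𝒢.cosyz G hG
    exact ⟨P, K, i, p, hP, hi, h𝒢.isDingProjective K hK⟩
  · obtain ⟨𝒢, h𝒢, hG⟩ := hD G hG
    exact h𝒢.ext G hG

namespace IsDingProjective

theorem exists_syz {G : Type u} [AddCommGroup G] [Module R G] (hG : IsDingProjective R G) :
    ∃ (K P : ModuleCat.{u} R) (i : K →ₗ[R] P) (p : P →ₗ[R] G),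
      Module.Projective R P ∧ IsShortExact i p ∧ IsDingProjective R K :=
  isDingClass_isDingProjective.syz (ModuleCat.of R G) hG

theorem exists_cosyz {G : Type u} [AddCommGroup G] [Module R G] (hG : IsDingProjective R G) :
    ∃ (P K : ModuleCat.{u} R) (i : G →ₗ[R] P) (p : P →ₗ[R] K),
      Module.Projective R P ∧ IsShortExact i p ∧ IsDingProjective R K :=
  isDingClass_isDingProjective.cosyz (ModuleCat.of R G) hG

/-- Induction on `n`. A map from the syzygy `G'` to `F` lifts to `F₀`, since `Ext¹(G', ker q) = 0`;
the lift extends to `P`, since `Ext¹(G, F₀) = 0`. -/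
theorem extVanishes {n : ℕ} : ∀ {G F : Type u} [AddCommGroup G] [Module R G] [AddCommGroup F]
    [Module R F], IsDingProjective R G → FlatDimLELeft R n F → ExtVanishes R G F := by
  induction n with
  | zero =>
    intro G F _ _ _ _ hG hF
    exact isDingClass_isDingProjective.ext (ModuleCat.of R G) hG F hF
  | succ n ih =>
    rintro G F _ _ _ _ hG ⟨F₀, q, hF₀, hq, hK⟩
    obtain ⟨G', P, i, p, hP, hi, hG'⟩ := hG.exists_syz
    refine ExtVanishes.of_projective hi fun f => ?_
    obtain ⟨g, hg⟩ := (ih hG' hK).exists_lift_map (IsShortExact.of_ker q hq) f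
    obtain ⟨k, hk⟩ := isDingClass_isDingProjective.ext (ModuleCat.of R G) hG F₀ hF₀ _ _ i p hi g
    exact ⟨q ∘ₗ k, fun x => by simp [hk, hg]⟩

end IsDingProjective

end

/-! ### Closure properties of Ding projective modules -/

section

variable {R : Type u} [Ring R]

theorem ExtVanishes.of_isProjective {G F : Type u} [AddCommGroup G] [Module R G] [AddCommGroup F]
    [Module R F] [Module.Projective R G] : ExtVanishes R G F := by
  intro X Y _ _ _ _ i p hi f
  obtain ⟨s, hs⟩ := Module.projective_lifting_property p LinearMap.id hi.surj
  obtain ⟨l, hl⟩ := exists_lift i hi.inj (LinearMap.id - s ∘ₗ p) fun y =>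
    (hi.exact _).mp (by
      have := LinearMap.congr_fun hs (p y)
      simp only [LinearMap.comp_apply, LinearMap.id_apply] at this
      simp [this])
  exact ⟨f ∘ₗ l, fun x => congrArg f (hi.inj (by simp [hl, hi.zero]))⟩

theorem projective_ker {P Q : Type u} [AddCommGroup P] [Module R P] [AddCommGroup Q] [Module R Q]
    [Module.Projective R P] [Module.Projective R Q] (p : P →ₗ[R] Q) (hp : Function.Surjective p) :
    Module.Projective R (LinearMap.ker p) := by
  obtain ⟨g, hg⟩ := ExtVanishes.of_isProjective (R := R) (G := Q) _ _ _ _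
    (IsShortExact.of_ker p hp) LinearMap.id
  exact Module.Projective.of_split (LinearMap.ker p).subtype g (LinearMap.ext hg)

theorem exists_horseshoe_syz {G G' G'' K' K'' P' P'' : Type u} [AddCommGroup G] [Module R G]
    [AddCommGroup G'] [Module R G'] [AddCommGroup G''] [Module R G'']
    [AddCommGroup K'] [Module R K'] [AddCommGroup K''] [Module R K'']
    [AddCommGroup P'] [Module R P'] [AddCommGroup P''] [Module R P'']
    [Module.Projective R P''] {a : G' →ₗ[R] G} {b : G →ₗ[R] G''} (hab : IsShortExact a b)
    {i' : K' →ₗ[R] P'} {p' : P' →ₗ[R] G'} (h' : IsShortExact i' p')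
    {i'' : K'' →ₗ[R] P''} {p'' : P'' →ₗ[R] G''} (h'' : IsShortExact i'' p'') :
    ∃ (p : P' × P'' →ₗ[R] G) (k : K' →ₗ[R] LinearMap.ker p) (q : LinearMap.ker p →ₗ[R] K''),
      Function.Surjective p ∧ IsShortExact k q := by
  obtain ⟨s, hs⟩ := Module.projective_lifting_property b p'' hab.surj
  replace hs : ∀ x, b (s x) = p'' x := fun x => LinearMap.congr_fun hs x
  let p : P' × P'' →ₗ[R] G := (a ∘ₗ p').coprod s
  have hp : ∀ x y, p (x, y) = a (p' x) + s y := fun x y => by simp [p]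
  obtain ⟨k, hk⟩ := exists_lift (LinearMap.ker p).subtype Subtype.val_injective
    (LinearMap.inl R P' P'' ∘ₗ i') fun z => ⟨⟨(i' z, 0), by simp [hp, h'.zero]⟩, rfl⟩
  obtain ⟨q, hq⟩ := exists_lift i'' h''.inj (LinearMap.snd R P' P'' ∘ₗ (LinearMap.ker p).subtype)
    (by
      rintro ⟨⟨x, y⟩, hxy⟩
      refine (h''.exact _).mp ?_
      have := congrArg b hxy
      simpa [hp, hab.zero, hs] using this)
  refine ⟨p, k, q, fun g => ?_, fun x y hxy => h'.inj ?_, fun z => ⟨fun hz => ?_, ?_⟩, fun z => ?_⟩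
  · obtain ⟨y, hy⟩ := h''.surj (b g)
    obtain ⟨z, hz⟩ := (hab.exact (g - s y)).mp (by simp [hs, hy])
    obtain ⟨x, rfl⟩ := h'.surj z
    exact ⟨(x, y), by simp [hp, hz]⟩
  · have := congrArg (LinearMap.ker p).subtype hxy
    rw [hk, hk] at this
    exact (Prod.ext_iff.mp this).1
  · obtain ⟨⟨x, y⟩, hxy⟩ := z
    have hy : y = 0 := by
      have := hq ⟨⟨x, y⟩, hxy⟩
      rw [hz, map_zero] at this
      exact this.symm
    subst hy
    obtain ⟨w, rfl⟩ := (h'.exact x).mp (hab.inj (by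
      rw [map_zero]
      simpa [hp] using hxy))
    exact ⟨w, Subtype.ext (hk w)⟩
  · rintro ⟨w, rfl⟩
    refine h''.inj ?_
    rw [hq, LinearMap.comp_apply, hk]
    simp
  · obtain ⟨w, hw⟩ := (hab.exact (s (i'' z))).mp (by simp [hs, h''.zero])
    obtain ⟨x, rfl⟩ := h'.surj w
    exact ⟨⟨(-x, i'' z), by simp [hp, hw]⟩, h''.inj (by rw [hq]; rfl)⟩

/-- The horseshoe usually needs `P'` injective, in order to extend `i'` from `G'` to `G`. Vanishing
of `Ext¹(G'', P')` does the same job. -/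
theorem exists_horseshoe_cosyz {G G' G'' K' K'' P' P'' : Type u} [AddCommGroup G] [Module R G]
    [AddCommGroup G'] [Module R G'] [AddCommGroup G''] [Module R G'']
    [AddCommGroup K'] [Module R K'] [AddCommGroup K''] [Module R K'']
    [AddCommGroup P'] [Module R P'] [AddCommGroup P''] [Module R P'']
    {a : G' →ₗ[R] G} {b : G →ₗ[R] G''} (hab : IsShortExact a b)
    (hext : ExtVanishes R G'' P')
    {i' : G' →ₗ[R] P'} {p' : P' →ₗ[R] K'} (h' : IsShortExact i' p')
    {i'' : G'' →ₗ[R] P''} {p'' : P'' →ₗ[R] K''} (h'' : IsShortExact i'' p'') :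
    ∃ (i : G →ₗ[R] P' × P'') (k : K' →ₗ[R] (P' × P'') ⧸ LinearMap.range i)
      (q : (P' × P'') ⧸ LinearMap.range i →ₗ[R] K''),
      Function.Injective i ∧ IsShortExact k q := by
  obtain ⟨s, hs⟩ := hext _ _ a b hab i'
  let i : G →ₗ[R] P' × P'' := s.prod (i'' ∘ₗ b)
  have hi : ∀ x, i x = (s x, i'' (b x)) := fun x => rfl
  have hmk : ∀ z, (LinearMap.range i).mkQ z = 0 ↔ ∃ x, i x = z := fun z => by simp
  obtain ⟨k, hk⟩ := exists_desc p' h'.surj ((LinearMap.range i).mkQ ∘ₗ LinearMap.inl R P' P'')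
    (by
      intro x hx
      obtain ⟨w, rfl⟩ := (h'.exact x).mp hx
      exact (hmk _).mpr ⟨a w, by simp [hi, hs, hab.zero]⟩)
  obtain ⟨q, hq⟩ := exists_desc (LinearMap.range i).mkQ (Submodule.mkQ_surjective _)
    (p'' ∘ₗ LinearMap.snd R P' P'') (by
      intro x hx
      obtain ⟨w, rfl⟩ := (hmk x).mp hx
      simp [hi, h''.zero])
  refine ⟨i, k, q, (injective_iff_map_eq_zero i).mpr fun x hx => ?_,
    (injective_iff_map_eq_zero k).mpr fun x hx => ?_, fun z => ⟨fun hz => ?_, ?_⟩, fun z => ?_⟩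
  · rw [hi, Prod.mk_eq_zero] at hx
    obtain ⟨y, rfl⟩ := (hab.exact x).mp (h''.inj (by rw [hx.2, map_zero]))
    rw [hs] at hx
    rw [h'.inj (hx.1.trans (map_zero i').symm), map_zero]
  · obtain ⟨y, rfl⟩ := h'.surj x
    rw [hk] at hx
    obtain ⟨w, hw⟩ := (hmk _).mp hx
    have hw := Prod.ext_iff.mp hw
    obtain ⟨v, rfl⟩ := (hab.exact w).mp (h''.inj (by rw [map_zero]; exact hw.2))
    have h1 : s (a v) = y := hw.1
    rw [← h1, hs, h'.zero]
  · obtain ⟨⟨x, y⟩, rfl⟩ := Submodule.mkQ_surjective _ z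
    rw [hq] at hz
    obtain ⟨w, rfl⟩ := (h''.exact y).mp hz
    obtain ⟨v, rfl⟩ := hab.surj w
    refine ⟨p' (x - s v), ?_⟩
    rw [hk, ← sub_eq_zero, LinearMap.comp_apply, ← map_sub]
    exact (hmk _).mpr ⟨-v, by simp [hi]⟩
  · rintro ⟨w, rfl⟩
    obtain ⟨w, rfl⟩ := h'.surj w
    rw [hk, LinearMap.comp_apply, hq]
    simp
  · obtain ⟨y, rfl⟩ := h''.surj z
    exact ⟨(LinearMap.range i).mkQ (0, y), by rw [hq]; simp⟩

namespace IsDingProjective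

variable {G G' G'' : Type u} [AddCommGroup G] [Module R G] [AddCommGroup G'] [Module R G']
  [AddCommGroup G''] [Module R G'']

/-- Ding projective modules are closed under extensions. -/
theorem extension {a : G' →ₗ[R] G} {b : G →ₗ[R] G''} (hab : IsShortExact a b)
    (h' : IsDingProjective R G') (h'' : IsDingProjective R G'') : IsDingProjective R G := by
  refine IsDingClass.isDingProjective (R := R)
    (𝒢 := fun G => ∃ (G' G'' : ModuleCat.{u} R) (a : G' →ₗ[R] G) (b : G →ₗ[R] G''),
      IsShortExact a b ∧ IsDingProjective R G' ∧ IsDingProjective R G'')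
    ⟨?_, ?_, ?_⟩ G ⟨ModuleCat.of R G', ModuleCat.of R G'', a, b, hab, h', h''⟩
  · rintro G ⟨G', G'', a, b, hab, h', h''⟩
    obtain ⟨K', P', i', p', hP', hi', hK'⟩ := h'.exists_syz
    obtain ⟨K'', P'', i'', p'', hP'', hi'', hK''⟩ := h''.exists_syz
    obtain ⟨p, k, q, hp, hk⟩ := exists_horseshoe_syz hab hi' hi''
    have hPP : Module.Projective R (P' × P'') := inferInstance
    exact ⟨ModuleCat.of R (LinearMap.ker p), ModuleCat.of R (P' × P''), _, p, hPP,
      IsShortExact.of_ker p hp, K', K'', k, q, hk, hK', hK''⟩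
  · rintro G ⟨G', G'', a, b, hab, h', h''⟩
    obtain ⟨P', K', i', p', hP', hi', hK'⟩ := h'.exists_cosyz
    obtain ⟨P'', K'', i'', p'', hP'', hi'', hK''⟩ := h''.exists_cosyz
    -- Projective modules are flat, so `Ext¹(G'', P') = 0`.
    obtain ⟨i, k, q, hi, hk⟩ := exists_horseshoe_cosyz hab
      (h''.extVanishes (n := 0) (IsFlatLeft.of_projective P')) hi' hi''
    have hPP : Module.Projective R (P' × P'') := inferInstance
    exact ⟨ModuleCat.of R (P' × P''), ModuleCat.of R ((P' × P'') ⧸ LinearMap.range i), i, _, hPP,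
      IsShortExact.of_mkQ i hi, K', K'', k, q, hk, hK', hK''⟩
  · rintro G ⟨G', G'', a, b, hab, h', h''⟩ F _ _ hF
    exact ExtVanishes.extension hab (h'.extVanishes (n := 0) hF) (h''.extVanishes (n := 0) hF)

theorem of_isProjective {P : Type u} [AddCommGroup P] [Module R P] [hP : Module.Projective R P] :
    IsDingProjective R P := by
  have hid : ∀ G : ModuleCat.{u} R, Function.Exact (LinearMap.id : G →ₗ[R] G)
      (0 : G →ₗ[R] PUnit.{u + 1}) := fun G x => by simp
  have hid' : ∀ G : ModuleCat.{u} R, Function.Exact (0 : PUnit.{u + 1} →ₗ[R] G)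
      (LinearMap.id : G →ₗ[R] G) := fun G x => by simp [eq_comm]
  have h0 : Module.Projective R PUnit.{u + 1} := inferInstance
  refine IsDingClass.isDingProjective (𝒢 := fun G => Module.Projective R G)
    ⟨fun G hG => ?_, fun G hG => ?_, fun G hG F _ _ _ => .of_isProjective⟩ P hP
  · exact ⟨ModuleCat.of R PUnit.{u + 1}, G, 0, LinearMap.id, hG,
      ⟨Function.injective_of_subsingleton _, hid' G, Function.surjective_id⟩, h0⟩
  · exact ⟨G, ModuleCat.of R PUnit.{u + 1}, LinearMap.id, 0, hG,
      ⟨Function.injective_id, hid G, fun x => ⟨0, rfl⟩⟩, h0⟩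

/-- A module with a projective complement in a Ding projective module is Ding projective. -/
theorem of_prod_projective {P : Type u} [AddCommGroup P] [Module R P] [hP : Module.Projective R P]
    (h : IsDingProjective R (P × G)) : IsDingProjective R G := by
  refine IsDingClass.isDingProjective (R := R)
    (𝒢 := fun G => ∃ P : ModuleCat.{u} R, Module.Projective R P ∧ IsDingProjective R (P × G))
    ⟨?_, ?_, ?_⟩ G ⟨ModuleCat.of R P, hP, h⟩
  · rintro G ⟨P, hP, h⟩
    obtain ⟨K, Q, i, p, hQ, hi, hK⟩ := h.exists_syz
    -- Given `Q → P × G` with kernel `K`, the part of `Q` lying over `0 × G` is the kernel of a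
    -- surjection onto `P`. It is projective, and it maps onto `G` with the same kernel `K`.
    let t : Q →ₗ[R] P := LinearMap.fst R P G ∘ₗ p
    have ht : Function.Surjective t := Prod.fst_surjective.comp hi.surj
    have htz : ∀ x : LinearMap.ker t, (p x).1 = 0 := fun x => x.2
    obtain ⟨j, hj⟩ := exists_lift (LinearMap.ker t).subtype Subtype.val_injective i fun x =>
      ⟨⟨i x, by simp [t, hi.zero]⟩, rfl⟩
    refine ⟨K, ModuleCat.of R (LinearMap.ker t), j,
      LinearMap.snd R P G ∘ₗ p ∘ₗ (LinearMap.ker t).subtype, projective_ker t ht,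
      ⟨fun x y hxy => hi.inj ?_, fun x => ⟨fun hx => ?_, ?_⟩, fun g => ?_⟩,
      ModuleCat.of R PUnit.{u + 1}, (inferInstance : Module.Projective R PUnit.{u + 1}), ?_⟩
    · rw [← hj, ← hj, hxy]
    · obtain ⟨y, hy⟩ := (hi.exact x.1).mp (Prod.ext (htz x) hx)
      exact ⟨y, Subtype.ext ((hj y).trans hy)⟩
    · rintro ⟨y, rfl⟩
      simp only [LinearMap.comp_apply, hj, hi.zero, map_zero]
    · obtain ⟨x, hx⟩ := hi.surj (0, g)
      exact ⟨⟨x, by simp [t, hx]⟩, by simp [hx]⟩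
    · exact hK.of_equiv LinearEquiv.uniqueProd.symm
  · rintro G ⟨P, hP, h⟩
    obtain ⟨Q, K, i, p, hQ, hi, hK⟩ := h.exists_cosyz
    have hj : Function.Injective (i ∘ₗ LinearMap.inr R P G) :=
      hi.inj.comp LinearMap.inr_injective
    let j := i ∘ₗ LinearMap.inr R P G
    have hmk : ∀ z, (LinearMap.range j).mkQ z = 0 ↔ ∃ x, i (0, x) = z := fun z => by simp [j]
    obtain ⟨q, hq⟩ := exists_desc (LinearMap.range j).mkQ (Submodule.mkQ_surjective _) p (by
      intro x hx
      obtain ⟨w, rfl⟩ := (hmk x).mp hx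
      exact hi.zero _)
    -- With `P × G` inside `Q`, the quotient `Q / G` is an extension of `K = Q / (P × G)` by `P`, so
    -- it is Ding projective and needs no complement.
    let s : P →ₗ[R] Q ⧸ LinearMap.range j := (LinearMap.range j).mkQ ∘ₗ i ∘ₗ LinearMap.inl R P G
    have hs : IsShortExact s q := by
      refine ⟨(injective_iff_map_eq_zero s).mpr fun x hx => ?_, fun z => ⟨fun hz => ?_, ?_⟩,
        fun z => ?_⟩
      · obtain ⟨w, hw⟩ := (hmk _).mp hx
        exact ((Prod.ext_iff.mp (hi.inj hw)).1).symm
      · obtain ⟨y, rfl⟩ := Submodule.mkQ_surjective _ z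
        rw [hq] at hz
        obtain ⟨⟨x, g⟩, rfl⟩ := (hi.exact y).mp hz
        refine ⟨x, ?_⟩
        rw [← sub_eq_zero]
        simp only [s, LinearMap.comp_apply, ← map_sub]
        exact (hmk _).mpr ⟨-g, by simp⟩
      · rintro ⟨w, rfl⟩
        simp only [s, LinearMap.comp_apply, hq, hi.zero]
      · obtain ⟨y, rfl⟩ := hi.surj z
        exact ⟨_, hq y⟩
    have hPD : IsDingProjective R P := of_isProjective
    refine ⟨Q, ModuleCat.of R (Q ⧸ LinearMap.range j), j, _, hQ, IsShortExact.of_mkQ j hj,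
      ModuleCat.of R PUnit.{u + 1}, (inferInstance : Module.Projective R PUnit.{u + 1}), ?_⟩
    exact (extension hs hPD hK).of_equiv LinearEquiv.uniqueProd.symm
  · rintro G ⟨P, hP, h⟩ F _ _ hF X Y _ _ _ _ i p hi f
    -- Adding `P` to the last two terms turns an extension of `G` into one of `P × G`.
    have h1 : IsShortExact (LinearMap.inr R P Y ∘ₗ i) (LinearMap.prodMap LinearMap.id p) := by
      refine ⟨LinearMap.inr_injective.comp hi.inj, fun z => ⟨fun hz => ?_, ?_⟩, fun z => ?_⟩
      · obtain ⟨x, y⟩ := z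
        have hz := Prod.ext_iff.mp hz
        obtain ⟨w, rfl⟩ := (hi.exact y).mp hz.2
        exact ⟨w, Prod.ext hz.1.symm rfl⟩
      · rintro ⟨w, rfl⟩
        simp [hi.zero]
      · obtain ⟨y, hy⟩ := hi.surj z.2
        exact ⟨(z.1, y), Prod.ext rfl hy⟩
    obtain ⟨g, hg⟩ := h.extVanishes (n := 0) hF _ _ _ _ h1 f
    exact ⟨g ∘ₗ LinearMap.inr R P Y, hg⟩

/-- The kernel of an epimorphism between Ding projective modules is Ding projective. -/
theorem of_isShortExact {a : G' →ₗ[R] G} {b : G →ₗ[R] G''} (hab : IsShortExact a b)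
    (h : IsDingProjective R G) (h'' : IsDingProjective R G'') : IsDingProjective R G' := by
  obtain ⟨K, P, i, p, hP, hi, hK⟩ := h''.exists_syz
  obtain ⟨s, hs⟩ := Module.projective_lifting_property b p hab.surj
  replace hs : ∀ x, b (s x) = p x := fun x => LinearMap.congr_fun hs x
  obtain ⟨t, ht⟩ := exists_lift a hab.inj (s ∘ₗ i) fun x =>
    (hab.exact _).mp (by simp [hs, hi.zero])
  -- The projective presentation of `G''` is compared with `G → G''`: the map `P × G' → G` given by
  -- `s` and `a` is onto with kernel `K`. So `P × G'` is an extension of `G` by `K`, and `P` can be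
  -- cancelled.
  refine of_prod_projective (P := P) (extension (a := i.prod (-t)) (b := s.coprod a) ?_ hK h)
  refine ⟨fun x y hxy => hi.inj (Prod.ext_iff.mp hxy).1, fun z => ⟨fun hz => ?_, ?_⟩, fun g => ?_⟩
  · obtain ⟨x, y⟩ := z
    simp only [LinearMap.coprod_apply] at hz
    obtain ⟨w, rfl⟩ := (hi.exact x).mp (by
      rw [← hs, eq_neg_of_add_eq_zero_left hz, map_neg, hab.zero, neg_zero])
    refine ⟨w, Prod.ext rfl (hab.inj ?_)⟩
    change a (-t w) = a y
    rw [map_neg, ht]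
    exact (eq_neg_of_add_eq_zero_right hz).symm
  · rintro ⟨w, rfl⟩
    simp [ht]
  · obtain ⟨x, hx⟩ := hi.surj (b g)
    obtain ⟨y, hy⟩ := (hab.exact (g - s x)).mp (by simp [hs, hx])
    exact ⟨(x, y), by simp [hy]⟩

/-- Tensoring with a right module of finite flat dimension preserves the exactness of sequences
ending in a Ding projective module. -/
theorem map_injective {n : ℕ} : ∀ {U : Type u} [AddCommGroup U] [Module Rᵐᵒᵖ U],
    FlatDimLERight R n U → ∀ {G X Y : Type u} [AddCommGroup G] [Module R G] [AddCommGroup X]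
      [Module R X] [AddCommGroup Y] [Module R Y] {i : X →ₗ[R] Y} {p : Y →ₗ[R] G},
      IsShortExact i p → IsDingProjective R G →
      Function.Injective (map (LinearMap.id : U →ₗ[Rᵐᵒᵖ] U) i) := by
  induction n with
  | zero =>
    intro U _ _ hU G X Y _ _ _ _ _ _ i p hi _
    exact hU _ _ i hi.inj
  | succ n ih =>
    rintro U _ _ ⟨F, q, hF, hq, hW⟩ G X Y _ _ _ _ _ _ i p hi hG
    refine injective_right_of_left (IsShortExact.of_ker q hq) hi (hF _ _ i hi.inj) ?_
    -- It remains to see that `ker q ⊗ G → F ⊗ G` is injective. Followed by the map to `F ⊗ P` it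
    -- equals `ker q ⊗ G → ker q ⊗ P → F ⊗ P`, injective by induction and by flatness of `P`.
    obtain ⟨P, K, j, r, hP, hj, hK⟩ := hG.exists_cosyz
    have h1 := (IsFlatLeft.of_projective (R := R) P _ _ (LinearMap.ker q).subtype
      Subtype.val_injective).comp (ih hW hj hK)
    intro x y hxy
    apply h1
    simp only [Function.comp_apply, map_comm, hxy]

end IsDingProjective

end

/-! ### Inflation along the projections of the triangular ring -/

namespace TriRing

variable (A B U : Type*) [Ring A] [Ring B] [AddCommGroup U] [Module B U] [Module Aᵐᵒᵖ U]
  [SMulCommClass B Aᵐᵒᵖ U]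

/-- The projection of the triangular matrix ring onto its upper left entry. -/
def fstHom : TriRing A B U →+* A where
  toFun := TriRing.a
  map_one' := rfl
  map_mul' _ _ := rfl
  map_zero' := rfl
  map_add' _ _ := rfl

/-- The projection of the triangular matrix ring onto its lower right entry. -/
def sndHom : TriRing A B U →+* B where
  toFun := TriRing.b
  map_one' := rfl
  map_mul' _ _ := rfl
  map_zero' := rfl
  map_add' _ _ := rfl

end TriRing

open TriRing

/-- Restriction of scalars of the module `F` along the ring homomorphism `π`. -/
def Restr {T A : Type*} [Ring T] [Ring A] (_π : T →+* A) (F : Type*) : Type _ := F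

namespace Restr

variable {T A : Type*} [Ring T] [Ring A] (π : T →+* A) {F G : Type*} [AddCommGroup F] [Module A F]
  [AddCommGroup G] [Module A G]

instance instAddCommGroup : AddCommGroup (Restr π F) := inferInstanceAs (AddCommGroup F)

instance instModule : Module T (Restr π F) := Module.compHom F π

variable {π} in
/-- The identity map from the restriction of `F` to `F`. -/
def out (x : Restr π F) : F := x

/-- The identity map from `F` to the restriction of `F`. -/
def of (x : F) : Restr π F := x

/-- The functoriality of restriction of scalars. -/
def map (f : F →ₗ[A] G) : Restr π F →ₗ[T] Restr π G where
  toFun := f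
  map_add' := f.map_add
  map_smul' t x := f.map_smul (π t) x

theorem map_isShortExact {H : Type*} [AddCommGroup H] [Module A H] {i : F →ₗ[A] G}
    {p : G →ₗ[A] H} (h : IsShortExact i p) : IsShortExact (map π i) (map π p) :=
  ⟨h.inj, h.exact, h.surj⟩

end Restr

/-- The inflation of `F` is a retract of `Restr π A ⊗_A F`, through `x ↦ 1 ⊗ x` and the action map,
so the bound for tensor products applies. -/
theorem FlatDimLELeft.restr_of_flat {T A : Type u} [Ring T] [Ring A] (π : T →+* A) {n : ℕ}
    (hA : FlatDimLELeft T n (Restr π A)) {F : Type u} [AddCommGroup F] [Module A F]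
    (hF : IsFlatLeft A F) : FlatDimLELeft T n (Restr π F) := by
  let _ : Module Aᵐᵒᵖ (Restr π A) := inferInstanceAs (Module Aᵐᵒᵖ A)
  have hs : ∀ (t : T) (x : A), t • Restr.of π x = Restr.of π (π t * x) := fun _ _ => rfl
  have hr : ∀ a x : A, MulOpposite.op a • Restr.of π x = Restr.of π (x * a) := fun _ _ => rfl
  have _ : SMulCommClass T Aᵐᵒᵖ (Restr π A) :=
    ⟨fun t a x => (mul_assoc (π t) x.out a.unop).symm⟩
  let ρ : BalTensor A (Restr π A) F →+ F :=
    lift₂ (fun a x => a.out • x) (fun a a' x => add_smul a.out a'.out x)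
      (fun a x y => smul_add a.out x y) (fun a b x => mul_smul a.out b x)
  refine (hA.balTensor hF).of_retract
    { toFun := fun x => tmul A (Restr.of π (1 : A)) x.out
      map_add' := fun x y => tmul_add _ _ _
      map_smul' := fun t x => ?_ }
    { toFun := fun z => Restr.of π (ρ z)
      map_add' := ρ.map_add
      map_smul' := fun t z => ?_ } fun x => ?_
  · rw [RingHom.id_apply, smul_tmul_left, hs, mul_one]
    change tmul A _ (π t • x.out) = _
    rw [← smul_tmul, hr, one_mul]
  · change ρ (t • z) = π t • ρ z
    induction z using induction_on with
    | zero => simp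
    | tmul a x =>
      rw [smul_tmul_left]
      exact mul_smul (π t) a.out x
    | add x y hx hy => rw [smul_add, map_add, map_add, hx, hy, smul_add]
  · exact one_smul A x.out

theorem FlatDimLELeft.of_surjective {R : Type u} [Ring R] {n : ℕ} {X F : Type u} [AddCommGroup X]
    [Module R X] [AddCommGroup F] [Module R F] (p : F →ₗ[R] X) (hF : IsFlatLeft R F)
    (hp : Function.Surjective p) (h : FlatDimLELeft R n (LinearMap.ker p)) :
    FlatDimLELeft R (n + 1) X :=
  ⟨ModuleCat.of R F, p, hF, hp, h⟩

theorem FlatDimLELeft.restr {T A : Type u} [Ring T] [Ring A] (π : T →+* A)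
    (hA : IsFlatLeft T (Restr π A)) {n : ℕ} : ∀ {F : Type u} [AddCommGroup F] [Module A F],
      FlatDimLELeft A n F → FlatDimLELeft T n (Restr π F) := by
  induction n with
  | zero =>
    intro F _ _ hF
    exact FlatDimLELeft.restr_of_flat (n := 0) π hA hF
  | succ n ih =>
    rintro F _ _ ⟨P, p, hP, hp, hK⟩
    -- The inflation of the kernel and the kernel of the inflated map have the same elements, but
    -- are different types.
    have h : FlatDimLELeft T n (LinearMap.ker (Restr.map π p)) := (ih hK).of_retract
      { toFun := fun x => Restr.of π (⟨x.1, x.2⟩ : LinearMap.ker p)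
        map_add' := fun x y => rfl
        map_smul' := fun t x => rfl }
      { toFun := fun x => ⟨x.out.1, x.out.2⟩
        map_add' := fun x y => rfl
        map_smul' := fun t x => rfl } fun x => rfl
    exact .of_surjective (Restr.map π p) (FlatDimLELeft.restr_of_flat (n := 0) π hA hP) hp h

namespace BalTensor

/-- The `B`-linear map `U ⊗_A f`. -/
def lmap {A : Type*} (B U : Type*) {N N' : Type*} [Ring A] [Ring B] [AddCommGroup U] [Module B U]
    [Module Aᵐᵒᵖ U] [SMulCommClass B Aᵐᵒᵖ U] [AddCommGroup N] [Module A N] [AddCommGroup N']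
    [Module A N'] (f : N →ₗ[A] N') : BalTensor A U N →ₗ[B] BalTensor A U N' where
  toFun := map LinearMap.id f
  map_add' := map_add _
  map_smul' b x := by
    rw [RingHom.id_apply]
    induction x using induction_on with
    | zero => simp
    | tmul u n => simp [smul_tmul_left, map_tmul]
    | add x y hx hy => simp only [smul_add, map_add, hx, hy]

theorem linearMap_ext {A B U N G : Type*} [Ring A] [Ring B] [AddCommGroup U] [Module B U]
    [Module Aᵐᵒᵖ U] [SMulCommClass B Aᵐᵒᵖ U] [AddCommGroup N] [Module A N] [AddCommGroup G]
    [Module B G] {f g : BalTensor A U N →ₗ[B] G}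
    (h : ∀ u n, f (tmul A u n) = g (tmul A u n)) (x : BalTensor A U N) : f x = g x :=
  DFunLike.congr_fun (addHom_ext (f := f.toAddMonoidHom) (g := g.toAddMonoidHom) h) x

section

variable {A B U N N' : Type*} [Ring A] [Ring B] [AddCommGroup U] [Module B U]
    [Module Aᵐᵒᵖ U] [SMulCommClass B Aᵐᵒᵖ U] [AddCommGroup N] [Module A N] [AddCommGroup N']
    [Module A N']

@[simp] theorem lmap_tmul (f : N →ₗ[A] N') (u : U) (n : N) :
    lmap B U f (tmul A u n) = tmul A u (f n) := map_tmul _ _ _ _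

end

end BalTensor

/-! ### Linear maps between triples -/

namespace TriModule

section

variable {A B U : Type*} [Ring A] [Ring B] [AddCommGroup U] [Module B U] [Module Aᵐᵒᵖ U]
  [SMulCommClass B Aᵐᵒᵖ U] {M₁ M₂ N₁ N₂ : Type*} [AddCommGroup M₁] [Module A M₁] [AddCommGroup M₂]
  [Module B M₂] [AddCommGroup N₁] [Module A N₁] [AddCommGroup N₂] [Module B N₂]
  {φ : BalTensor A U M₁ →ₗ[B] M₂} {ψ : BalTensor A U N₁ →ₗ[B] N₂}

variable (φ) in
/-- The column vector with entries `x` and `y`. -/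
def mk (x : M₁) (y : M₂) : TriModule φ := ((x, y) : M₁ × M₂)

/-- The upper entry of a column vector. -/
def fst (m : TriModule φ) : M₁ := m.1

/-- The lower entry of a column vector. -/
def snd (m : TriModule φ) : M₂ := m.2

@[simp] theorem fst_mk (x : M₁) (y : M₂) : (mk φ x y).fst = x := rfl
@[simp] theorem snd_mk (x : M₁) (y : M₂) : (mk φ x y).snd = y := rfl
@[simp] theorem fst_add (m n : TriModule φ) : (m + n).fst = m.fst + n.fst := rfl
@[simp] theorem snd_add (m n : TriModule φ) : (m + n).snd = m.snd + n.snd := rfl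
@[simp] theorem fst_smul (t : TriRing A B U) (m : TriModule φ) : (t • m).fst = t.a • m.fst := rfl
@[simp] theorem snd_smul (t : TriRing A B U) (m : TriModule φ) :
    (t • m).snd = φ (tmul A t.u m.fst) + t.b • m.snd := rfl

@[ext] theorem ext {m n : TriModule φ} (h₁ : m.fst = n.fst) (h₂ : m.snd = n.snd) : m = n :=
  Prod.ext h₁ h₂

theorem mk_inj {x x' : M₁} {y y' : M₂} : mk φ x y = mk φ x' y' ↔ x = x' ∧ y = y' :=
  Prod.mk_inj

variable (φ ψ) in
/-- The linear map with given components. -/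
def homMk (f₁ : M₁ →ₗ[A] N₁) (f₂ : M₂ →ₗ[B] N₂)
    (h : ∀ u x, f₂ (φ (tmul A u x)) = ψ (tmul A u (f₁ x))) :
    TriModule φ →ₗ[TriRing A B U] TriModule ψ where
  toFun m := mk ψ (f₁ m.fst) (f₂ m.snd)
  map_add' m n := by ext <;> simp
  map_smul' t m := by ext <;> simp [h]

/-- The upper component of a linear map. -/
def homFst (f : TriModule φ →ₗ[TriRing A B U] TriModule ψ) : M₁ →ₗ[A] N₁ where
  toFun x := (f (mk φ x 0)).fst
  map_add' x y := by
    rw [← fst_add, ← map_add]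
    congr 2
    ext <;> simp
  map_smul' a x := by
    have : mk φ (a • x) 0 = (⟨a, 0, 0⟩ : TriRing A B U) • mk φ x 0 := by
      ext <;> simp [zero_tmul]
    rw [this, map_smul]
    simp

/-- The lower component of a linear map. -/
def homSnd (f : TriModule φ →ₗ[TriRing A B U] TriModule ψ) : M₂ →ₗ[B] N₂ where
  toFun y := (f (mk φ 0 y)).snd
  map_add' x y := by
    rw [← snd_add, ← map_add]
    congr 2
    ext <;> simp
  map_smul' b y := by
    have : mk φ 0 (b • y) = (⟨0, 0, b⟩ : TriRing A B U) • mk φ 0 y := by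
      ext <;> simp [zero_tmul]
    rw [this, map_smul]
    simp [zero_tmul]

theorem apply_mk_zero_left (f : TriModule φ →ₗ[TriRing A B U] TriModule ψ) (y : M₂) :
    f (mk φ 0 y) = mk ψ 0 (homSnd f y) := by
  have : mk φ 0 y = (⟨0, 0, 1⟩ : TriRing A B U) • mk φ 0 y := by
    ext <;> simp [zero_tmul]
  ext
  · rw [this, map_smul]; simp
  · rfl

theorem apply_mk_zero_right (f : TriModule φ →ₗ[TriRing A B U] TriModule ψ) (x : M₁) :
    f (mk φ x 0) = mk ψ (homFst f x) 0 := by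
  have : mk φ x 0 = (⟨1, 0, 0⟩ : TriRing A B U) • mk φ x 0 := by
    ext <;> simp [zero_tmul]
  ext
  · rfl
  · rw [this, map_smul]; simp [zero_tmul]

theorem mk_add_mk (m : TriModule φ) : mk φ m.fst 0 + mk φ 0 m.snd = m := by
  ext <;> simp

theorem apply_eq (f : TriModule φ →ₗ[TriRing A B U] TriModule ψ) (m : TriModule φ) :
    f m = mk ψ (homFst f m.fst) (homSnd f m.snd) := by
  conv_lhs => rw [← mk_add_mk m]
  rw [map_add, apply_mk_zero_left, apply_mk_zero_right]
  ext <;> simp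

theorem smul_mk_zero (u : U) (x : M₁) :
    (⟨0, u, 0⟩ : TriRing A B U) • mk φ x 0 = mk φ 0 (φ (tmul A u x)) := by
  ext <;> simp

/-- Commutation with the matrix whose only nonzero entry is `u` is exactly compatibility with the
structure maps. -/
theorem homSnd_apply (f : TriModule φ →ₗ[TriRing A B U] TriModule ψ) (z : BalTensor A U M₁) :
    homSnd f (φ z) = ψ (lmap B U (homFst f) z) := by
  refine linearMap_ext (f := homSnd f ∘ₗ φ) (g := ψ ∘ₗ lmap B U (homFst f)) (fun u x => ?_) z
  have h := congrArg f (smul_mk_zero (φ := φ) u x)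
  rw [map_smul, apply_mk_zero_right, smul_mk_zero, apply_mk_zero_left] at h
  simpa using (congrArg snd h).symm

theorem isShortExact_iff {L₁ L₂ : Type*} [AddCommGroup L₁] [Module A L₁]
    [AddCommGroup L₂] [Module B L₂] {χ : BalTensor A U L₁ →ₗ[B] L₂}
    {f : TriModule φ →ₗ[TriRing A B U] TriModule ψ}
    {g : TriModule ψ →ₗ[TriRing A B U] TriModule χ} :
    IsShortExact f g ↔ IsShortExact (homFst f) (homFst g) ∧
      IsShortExact (homSnd f) (homSnd g) := by
  constructor
  · intro h
    refine ⟨⟨fun x y hxy => ?_, fun x => ⟨fun hx => ?_, ?_⟩, fun x => ?_⟩,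
      ⟨fun x y hxy => ?_, fun x => ⟨fun hx => ?_, ?_⟩, fun x => ?_⟩⟩
    · exact congrArg fst (h.inj (a₁ := mk φ x 0) (a₂ := mk φ y 0) (by
        rw [apply_mk_zero_right, apply_mk_zero_right, hxy]))
    · obtain ⟨m, hm⟩ := (h.exact (mk ψ x 0)).mp (by rw [apply_mk_zero_right, hx]; rfl)
      rw [apply_eq] at hm
      exact ⟨m.fst, congrArg fst hm⟩
    · rintro ⟨y, rfl⟩
      have := h.zero (mk φ y 0)
      rw [apply_mk_zero_right, apply_mk_zero_right] at this
      exact congrArg fst this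
    · obtain ⟨m, hm⟩ := h.surj (mk χ x 0)
      rw [apply_eq] at hm
      exact ⟨m.fst, congrArg fst hm⟩
    · exact congrArg snd (h.inj (a₁ := mk φ 0 x) (a₂ := mk φ 0 y) (by
        rw [apply_mk_zero_left, apply_mk_zero_left, hxy]))
    · obtain ⟨m, hm⟩ := (h.exact (mk ψ 0 x)).mp (by rw [apply_mk_zero_left, hx]; rfl)
      rw [apply_eq] at hm
      exact ⟨m.snd, congrArg snd hm⟩
    · rintro ⟨y, rfl⟩
      have := h.zero (mk φ 0 y)
      rw [apply_mk_zero_left, apply_mk_zero_left] at this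
      exact congrArg snd this
    · obtain ⟨m, hm⟩ := h.surj (mk χ 0 x)
      rw [apply_eq] at hm
      exact ⟨m.snd, congrArg snd hm⟩
  · rintro ⟨h₁, h₂⟩
    refine ⟨fun x y hxy => ?_, fun x => ⟨fun hx => ?_, ?_⟩, fun x => ?_⟩
    · rw [apply_eq, apply_eq] at hxy
      have e₁ : homFst f x.fst = homFst f y.fst := (mk_inj.mp hxy).1
      have e₂ : homSnd f x.snd = homSnd f y.snd := (mk_inj.mp hxy).2
      exact ext (h₁.inj e₁) (h₂.inj e₂)
    · rw [apply_eq] at hx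
      obtain ⟨y₁, hy₁⟩ := (h₁.exact x.fst).mp (congrArg fst hx)
      obtain ⟨y₂, hy₂⟩ := (h₂.exact x.snd).mp (congrArg snd hx)
      exact ⟨mk φ y₁ y₂, by rw [apply_eq]; exact ext hy₁ hy₂⟩
    · rintro ⟨y, rfl⟩
      rw [apply_eq f, apply_eq g]
      exact ext (h₁.zero _) (h₂.zero _)
    · obtain ⟨y₁, hy₁⟩ := h₁.surj x.fst
      obtain ⟨y₂, hy₂⟩ := h₂.surj x.snd
      exact ⟨mk ψ y₁ y₂, by rw [apply_eq]; exact ext hy₁ hy₂⟩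

variable (φ) in
/-- Maps into a module inflated along `T → A` are maps out of the upper component. -/
def toRestrFst {F : Type*} [AddCommGroup F] [Module A F] (h : M₁ →ₗ[A] F) :
    TriModule φ →ₗ[TriRing A B U] Restr (fstHom A B U) F where
  toFun m := h m.fst
  map_add' _ _ := h.map_add _ _
  map_smul' _ _ := h.map_smul _ _

theorem exists_ofRestrFst {F : Type*} [AddCommGroup F] [Module A F]
    (k : TriModule φ →ₗ[TriRing A B U] Restr (fstHom A B U) F) :
    ∃ h : M₁ →ₗ[A] F, ∀ m, k m = h m.fst := by
  have h0 : ∀ y, k (mk φ 0 y) = 0 := fun y => by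
    have : mk φ 0 y = (⟨0, 0, 1⟩ : TriRing A B U) • mk φ 0 y := by
      ext <;> simp [zero_tmul]
    rw [this, map_smul]
    exact zero_smul A (k (mk φ 0 y)).out
  refine ⟨{ toFun := fun x => k (mk φ x 0)
            map_add' := fun x y => ?_
            map_smul' := fun a x => ?_ }, fun m => ?_⟩
  · refine Eq.trans (congrArg k ?_) (k.map_add (mk φ x 0) (mk φ y 0))
    ext <;> simp
  · refine Eq.trans (congrArg k ?_) (k.map_smul ⟨a, 0, 0⟩ (mk φ x 0))
    ext <;> simp [zero_tmul]
  · change k m = k (mk φ m.fst 0)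
    conv_lhs => rw [← mk_add_mk m]
    rw [map_add, h0, add_zero]

variable (φ) in
/-- Maps into a module inflated along `T → B` are maps out of the cokernel of `φ`. -/
def toRestrSnd {F : Type*} [AddCommGroup F] [Module B F] (h : M₂ →ₗ[B] F)
    (h0 : ∀ z, h (φ z) = 0) :
    TriModule φ →ₗ[TriRing A B U] Restr (sndHom A B U) F where
  toFun m := h m.snd
  map_add' _ _ := h.map_add _ _
  map_smul' t m := by
    rw [snd_smul, map_add, h0, zero_add, map_smul]
    rfl

/-- The upper left idempotent acts as zero on the inflated module, so `k` kills upper entries. The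
lower left entries carry these onto the image of `φ`, which `h` therefore kills too. -/
theorem exists_ofRestrSnd {F : Type*} [AddCommGroup F] [Module B F]
    (k : TriModule φ →ₗ[TriRing A B U] Restr (sndHom A B U) F) :
    ∃ h : M₂ →ₗ[B] F, (∀ z, h (φ z) = 0) ∧ ∀ m, k m = h m.snd := by
  have h0 : ∀ x, k (mk φ x 0) = 0 := fun x => by
    have : mk φ x 0 = (⟨1, 0, 0⟩ : TriRing A B U) • mk φ x 0 := by
      ext <;> simp [zero_tmul]
    rw [this, map_smul]
    exact zero_smul B (k (mk φ x 0)).out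
  let h : M₂ →ₗ[B] F :=
    { toFun := fun y => k (mk φ 0 y)
      map_add' := fun x y => by
        refine Eq.trans (congrArg k ?_) (k.map_add (mk φ 0 x) (mk φ 0 y))
        ext <;> simp
      map_smul' := fun b x => by
        refine Eq.trans (congrArg k ?_) (k.map_smul ⟨0, 0, b⟩ (mk φ 0 x))
        ext <;> simp [zero_tmul] }
  refine ⟨h, fun z => ?_, fun m => ?_⟩
  · refine linearMap_ext (f := h ∘ₗ φ) (g := 0) (fun u x => ?_) z
    change k (mk φ 0 (φ (tmul A u x))) = 0
    rw [← smul_mk_zero, map_smul, h0, smul_zero]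
  · change k m = k (mk φ 0 m.snd)
    conv_lhs => rw [← mk_add_mk m]
    rw [map_add, h0, zero_add]

variable (ψ) in
/-- Maps out of a module inflated along `T → B` are maps into the lower component. -/
def ofRestrSnd {F : Type*} [AddCommGroup F] [Module B F] (h : F →ₗ[B] N₂) :
    Restr (sndHom A B U) F →ₗ[TriRing A B U] TriModule ψ where
  toFun x := mk ψ 0 (h x)
  map_add' x y := ext (add_zero 0).symm (h.map_add x y)
  map_smul' t x := by
    refine ext (smul_zero t.a).symm ?_
    rw [RingHom.id_apply, snd_smul, fst_mk, tmul_zero, map_zero, zero_add]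
    exact h.map_smul t.b x

theorem exists_toRestrSnd {F : Type*} [AddCommGroup F] [Module B F]
    (k : Restr (sndHom A B U) F →ₗ[TriRing A B U] TriModule ψ) :
    ∃ h : F →ₗ[B] N₂, ∀ x, k x = mk ψ 0 (h x) := by
  have h0 : ∀ x, (k x).fst = 0 := fun x => by
    have : (⟨0, 0, 1⟩ : TriRing A B U) • x = x := one_smul B x.out
    rw [← this, map_smul, fst_smul, zero_smul]
  refine ⟨{ toFun := fun x => (k x).snd
            map_add' := fun x y => congrArg snd (k.map_add x y)
            map_smul' := fun b x => ?_ }, fun x => ext (h0 x) rfl⟩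
  refine (congrArg snd (k.map_smul ⟨0, 0, b⟩ x)).trans ?_
  simp [zero_tmul]

end

/-! ### Every module over the triangular ring is a triple -/

section decomposition

variable (A B U : Type u) [Ring A] [Ring B] [AddCommGroup U] [Module B U] [Module Aᵐᵒᵖ U]
  [SMulCommClass B Aᵐᵒᵖ U] (X : Type u) [AddCommGroup X] [Module (TriRing A B U) X]

/-- The elements of `X` fixed by the upper left matrix unit. -/
def fstPart : AddSubgroup X where
  carrier := {x | (⟨1, 0, 0⟩ : TriRing A B U) • x = x}
  add_mem' {x y} hx hy := by
    simp only [Set.mem_ofPred_eq] at *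
    rw [smul_add, hx, hy]
  zero_mem' := smul_zero _
  neg_mem' {x} hx := by
    simp only [Set.mem_ofPred_eq] at *
    rw [smul_neg, hx]

/-- The elements of `X` fixed by the lower right matrix unit. -/
def sndPart : AddSubgroup X where
  carrier := {x | (⟨0, 0, 1⟩ : TriRing A B U) • x = x}
  add_mem' {x y} hx hy := by
    simp only [Set.mem_ofPred_eq] at *
    rw [smul_add, hx, hy]
  zero_mem' := smul_zero _
  neg_mem' {x} hx := by
    simp only [Set.mem_ofPred_eq] at *
    rw [smul_neg, hx]

variable {A B U X} in
theorem smul_smul_eq {s t r : TriRing A B U} (h : s * t = r) (x : X) : s • t • x = r • x := by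
  rw [smul_smul, h]

instance fstPart.instModule : Module A (fstPart A B U X) where
  smul a x := ⟨(⟨a, 0, 0⟩ : TriRing A B U) • x.1, smul_smul_eq (by ext <;> simp) x.1⟩
  one_smul x := Subtype.ext x.2
  mul_smul a b x := Subtype.ext <| by
    change _ • _ = _ • _ • _
    rw [smul_smul]
    congr 1
    ext <;> simp
  smul_zero a := Subtype.ext (smul_zero _)
  smul_add a x y := Subtype.ext (smul_add _ _ _)
  add_smul a b x := Subtype.ext <| by
    change _ • _ = _ • _ + _ • _
    rw [← add_smul]
    congr 1
    ext <;> simp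
  zero_smul x := Subtype.ext (zero_smul (TriRing A B U) x.1)

instance sndPart.instModule : Module B (sndPart A B U X) where
  smul b x := ⟨(⟨0, 0, b⟩ : TriRing A B U) • x.1, smul_smul_eq (by ext <;> simp) x.1⟩
  one_smul x := Subtype.ext x.2
  mul_smul a b x := Subtype.ext <| by
    change _ • _ = _ • _ • _
    rw [smul_smul]
    congr 1
    ext <;> simp
  smul_zero a := Subtype.ext (smul_zero _)
  smul_add a x y := Subtype.ext (smul_add _ _ _)
  add_smul a b x := Subtype.ext <| by
    change _ • _ = _ • _ + _ • _
    rw [← add_smul]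
    congr 1
    ext <;> simp
  zero_smul x := Subtype.ext (zero_smul (TriRing A B U) x.1)

/-- The Peirce decomposition: the two diagonal idempotents sum to `1` and cut `X` into its entries;
the lower left entries of the ring map the first into the second, which defines `φ`. -/
theorem exists_equiv : ∃ (M₁ : ModuleCat.{u} A) (M₂ : ModuleCat.{u} B)
    (φ : BalTensor A U M₁ →ₗ[B] M₂), Nonempty (X ≃ₗ[TriRing A B U] TriModule φ) := by
  let φ₀ : BalTensor A U (fstPart A B U X) →+ sndPart A B U X :=
    lift₂ (fun u x => ⟨(⟨0, u, 0⟩ : TriRing A B U) • x.1, smul_smul_eq (by ext <;> simp) x.1⟩)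
      (fun u v x => Subtype.ext <| by
        change _ • _ = _ • _ + _ • _
        rw [← add_smul]
        congr 1
        ext <;> simp)
      (fun u x y => Subtype.ext (smul_add _ _ _))
      (fun u a x => Subtype.ext <| by
        change _ • _ = _ • _ • _
        rw [smul_smul]
        congr 1
        ext <;> simp)
  let φ : BalTensor A U (fstPart A B U X) →ₗ[B] sndPart A B U X :=
    { toFun := φ₀
      map_add' := φ₀.map_add
      map_smul' := fun b z => by
        rw [RingHom.id_apply]
        induction z using induction_on with
        | zero => simp
        | tmul u x =>
          rw [smul_tmul_left]
          refine Subtype.ext ?_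
          change _ • _ = _ • _ • _
          rw [smul_smul]
          congr 1
          ext <;> simp
        | add x y hx hy => simp only [smul_add, map_add, hx, hy] }
  let f : X →ₗ[TriRing A B U] TriModule φ :=
    { toFun := fun x => mk φ
        ⟨(⟨1, 0, 0⟩ : TriRing A B U) • x, smul_smul_eq (by ext <;> simp) x⟩
        ⟨(⟨0, 0, 1⟩ : TriRing A B U) • x, smul_smul_eq (by ext <;> simp) x⟩
      map_add' := fun x y => ext (Subtype.ext (smul_add _ _ _)) (Subtype.ext (smul_add _ _ _))
      map_smul' := fun t x => by
        refine ext (Subtype.ext ?_) (Subtype.ext ?_)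
        · change (⟨1, 0, 0⟩ : TriRing A B U) • t • x =
            (⟨t.a, 0, 0⟩ : TriRing A B U) • (⟨1, 0, 0⟩ : TriRing A B U) • x
          rw [smul_smul, smul_smul]
          congr 1
          ext <;> simp
        · change (⟨0, 0, 1⟩ : TriRing A B U) • t • x =
            (⟨0, t.u, 0⟩ : TriRing A B U) • (⟨1, 0, 0⟩ : TriRing A B U) • x +
              (⟨0, 0, t.b⟩ : TriRing A B U) • (⟨0, 0, 1⟩ : TriRing A B U) • x
          rw [smul_smul, smul_smul, smul_smul, ← add_smul]
          congr 1
          ext <;> simp }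
  refine ⟨ModuleCat.of A (fstPart A B U X), ModuleCat.of B (sndPart A B U X), φ,
    ⟨LinearEquiv.ofBijective f ⟨(injective_iff_map_eq_zero f).mpr fun x hx => ?_, fun m => ?_⟩⟩⟩
  · have h₁ : (⟨1, 0, 0⟩ : TriRing A B U) • x = 0 := congrArg (fun m => (fst m).1) hx
    have h₂ : (⟨0, 0, 1⟩ : TriRing A B U) • x = 0 := congrArg (fun m => (snd m).1) hx
    rw [← one_smul (TriRing A B U) x, show (1 : TriRing A B U) = ⟨1, 0, 0⟩ + ⟨0, 0, 1⟩ by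
      ext <;> simp, add_smul, h₁, h₂, add_zero]
  · have h₁ : (⟨1, 0, 0⟩ : TriRing A B U) • m.fst.1 = m.fst.1 := m.fst.2
    have h₂ : (⟨0, 0, 1⟩ : TriRing A B U) • m.snd.1 = m.snd.1 := m.snd.2
    have h₃ : (⟨1, 0, 0⟩ : TriRing A B U) • m.snd.1 = 0 := by
      rw [← h₂, smul_smul, ← zero_smul (TriRing A B U) m.snd.1]
      congr 1
      ext <;> simp
    have h₄ : (⟨0, 0, 1⟩ : TriRing A B U) • m.fst.1 = 0 := by
      rw [← h₁, smul_smul, ← zero_smul (TriRing A B U) m.fst.1]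
      congr 1
      ext <;> simp
    refine ⟨m.fst.1 + m.snd.1, ext (Subtype.ext ?_) (Subtype.ext ?_)⟩
    · change _ • _ = _
      rw [smul_add, h₁, h₃, add_zero]
    · change _ • _ = _
      rw [smul_add, h₄, h₂, zero_add]

end decomposition

end TriModule

/-! ### Projective and induced modules over the triangular ring -/

namespace TriModule

variable {A B U : Type u} [Ring A] [Ring B] [AddCommGroup U] [Module B U] [Module Aᵐᵒᵖ U]
  [SMulCommClass B Aᵐᵒᵖ U]

section projective

variable {M₁ M₂ : Type u} [AddCommGroup M₁] [Module A M₁] [AddCommGroup M₂] [Module B M₂]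
  {φ : BalTensor A U M₁ →ₗ[B] M₂}

theorem projective_of_split {R : Type u} [Ring R] (P : Type u) [AddCommGroup P] [Module R P]
    (h : ∀ (X : ModuleCat.{u} R) (p : X →ₗ[R] P), Function.Surjective p →
      ∃ s : P →ₗ[R] X, ∀ x, p (s x) = x) : Module.Projective R P := by
  obtain ⟨X, p, hX, hp⟩ := exists_surjective_free R P
  obtain ⟨s, hs⟩ := h X p hp
  exact Module.Projective.of_split s p (LinearMap.ext hs)

theorem projective_of_split_tri (P : Type u) [AddCommGroup P] [Module (TriRing A B U) P]
    (h : ∀ (M₁ : ModuleCat.{u} A) (M₂ : ModuleCat.{u} B) (φ : BalTensor A U M₁ →ₗ[B] M₂)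
      (p : TriModule φ →ₗ[TriRing A B U] P), Function.Surjective p →
      ∃ s : P →ₗ[TriRing A B U] TriModule φ, ∀ x, p (s x) = x) :
    Module.Projective (TriRing A B U) P := by
  refine projective_of_split P fun X p hp => ?_
  obtain ⟨M₁, M₂, φ, ⟨e⟩⟩ := exists_equiv A B U X
  obtain ⟨s, hs⟩ := h M₁ M₂ φ (p ∘ₗ e.symm.toLinearMap) (hp.comp e.symm.surjective)
  exact ⟨e.symm.toLinearMap ∘ₗ s, hs⟩

/-- Taking the upper entry is left adjoint to inflation along `T → A`, which preserves surjections.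
-/
theorem projective_fst [Module.Projective (TriRing A B U) (TriModule φ)] :
    Module.Projective A M₁ := by
  refine projective_of_split M₁ fun X p hp => ?_
  obtain ⟨k, hk⟩ := Module.projective_lifting_property (Restr.map (fstHom A B U) p)
    (toRestrFst φ LinearMap.id) hp
  obtain ⟨h, hh⟩ := exists_ofRestrFst k
  refine ⟨h, fun x => ?_⟩
  have h1 := LinearMap.congr_fun hk (mk φ x 0)
  rw [LinearMap.comp_apply, hh] at h1
  exact h1

/-- The cokernel of `φ` is likewise left adjoint to inflation along `T → B`. -/
theorem projective_coker [Module.Projective (TriRing A B U) (TriModule φ)] {C : Type u}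
    [AddCommGroup C] [Module B C] {q : M₂ →ₗ[B] C} (hq : Function.Surjective q)
    (hφ : Function.Exact φ q) : Module.Projective B C := by
  refine projective_of_split C fun X p hp => ?_
  obtain ⟨k, hk⟩ := Module.projective_lifting_property (Restr.map (sndHom A B U) p)
    (toRestrSnd φ q hφ.apply_apply_eq_zero) hp
  obtain ⟨h, h0, hh⟩ := exists_ofRestrSnd k
  obtain ⟨g, hg⟩ := exists_desc q hq h fun y hy => by
    obtain ⟨z, rfl⟩ := (hφ y).mp hy
    exact h0 z
  refine ⟨g, fun x => ?_⟩
  obtain ⟨y, rfl⟩ := hq x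
  have h1 := LinearMap.congr_fun hk (mk φ 0 y)
  rw [LinearMap.comp_apply, hh] at h1
  rw [hg]
  exact h1

/-- The triple `(M₁, (U ⊗ M₁) × M₂)` with structure map the first inclusion maps onto `(M₁, M₂)`, by
the identity above. The lower component of a section carries `φ` to that inclusion. -/
theorem injective_of_projective [Module.Projective (TriRing A B U) (TriModule φ)] :
    Function.Injective φ := by
  let ψ := LinearMap.inl B (BalTensor A U M₁) M₂
  let p : TriModule ψ →ₗ[TriRing A B U] TriModule φ :=
    homMk ψ φ LinearMap.id (φ.coprod LinearMap.id) (fun u x => by simp [ψ])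
  have hp : Function.Surjective p := fun m =>
    ⟨mk ψ m.fst (0, m.snd), by ext <;> simp [p, homMk]⟩
  obtain ⟨s, hs⟩ := Module.projective_lifting_property p LinearMap.id hp
  have h1 : ∀ x, homFst s x = x := fun x => by
    have := congrArg fst (LinearMap.congr_fun hs (mk φ x 0))
    rw [LinearMap.comp_apply, apply_mk_zero_right] at this
    exact this
  have h2 : ∀ z, homSnd s (φ z) = ψ z := fun z => by
    rw [homSnd_apply, show homFst s = LinearMap.id from LinearMap.ext h1]
    exact congrArg ψ (map_id_id z)
  intro x y hxy
  have h3 := congrArg (homSnd s) hxy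
  rw [h2, h2] at h3
  exact LinearMap.inl_injective h3

theorem projective_restr_snd {P : Type u} [AddCommGroup P] [Module B P] [Module.Projective B P] :
    Module.Projective (TriRing A B U) (Restr (sndHom A B U) P) := by
  refine projective_of_split_tri _ fun M₁ M₂ φ p hp => ?_
  obtain ⟨h, h0, hh⟩ := exists_ofRestrSnd p
  have hs : Function.Surjective h := fun x => by
    obtain ⟨m, hm⟩ := hp (Restr.of _ x)
    exact ⟨m.snd, (hh m).symm.trans hm⟩
  obtain ⟨s, hs⟩ := Module.projective_lifting_property h LinearMap.id hs
  exact ⟨ofRestrSnd φ s, fun x => (hh _).trans (LinearMap.congr_fun hs x.out)⟩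

end projective

section induced

variable (A B U) in
/-- The induced module `(N, U ⊗_A N)`. -/
abbrev Ind (N : Type*) [AddCommGroup N] [Module A N] : Type _ :=
  TriModule (LinearMap.id : BalTensor A U N →ₗ[B] BalTensor A U N)

variable {N N' N'' N₁ N₂ : Type u} [AddCommGroup N] [Module A N] [AddCommGroup N'] [Module A N']
  [AddCommGroup N''] [Module A N''] [AddCommGroup N₁] [Module A N₁] [AddCommGroup N₂] [Module B N₂]

/-- The adjunction between `N ↦ (N, U ⊗_A N)` and the upper component. -/
def indLift (ψ : BalTensor A U N₁ →ₗ[B] N₂) (f : N →ₗ[A] N₁) :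
    Ind A B U N →ₗ[TriRing A B U] TriModule ψ :=
  homMk _ ψ f (ψ ∘ₗ lmap B U f) fun u x => by simp

/-- The structure map of an induced module is the identity, so the upper component determines the
lower one. -/
theorem ind_hom_ext {ψ : BalTensor A U N₁ →ₗ[B] N₂} {f g : Ind A B U N →ₗ[TriRing A B U] TriModule ψ}
    (h : homFst f = homFst g) : f = g := by
  refine LinearMap.ext fun m => ?_
  have h2 := homSnd_apply f m.snd
  rw [h, ← homSnd_apply g] at h2
  rw [apply_eq f, apply_eq g, h]
  exact ext rfl h2

theorem indLift_isShortExact {i : N →ₗ[A] N'} {p : N' →ₗ[A] N''} (h : IsShortExact i p)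
    (hU : Function.Injective (map (LinearMap.id : U →ₗ[Aᵐᵒᵖ] U) i)) :
    IsShortExact (indLift (LinearMap.id : BalTensor A U N' →ₗ[B] BalTensor A U N') i)
      (indLift (LinearMap.id : BalTensor A U N'' →ₗ[B] BalTensor A U N'') p) :=
  isShortExact_iff.mpr ⟨h, hU,
    fun x => ⟨map_right_exact h.exact h.surj x,
      by rintro ⟨y, rfl⟩; exact map_right_eq_zero h.zero y⟩,
    map_surjective Function.surjective_id h.surj⟩

theorem projective_ind [Module.Projective A N] : Module.Projective (TriRing A B U) (Ind A B U N) := by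
  refine projective_of_split_tri _ fun M₁ M₂ φ p hp => ?_
  have hs : Function.Surjective (homFst p) := fun x => by
    obtain ⟨m, hm⟩ := hp (mk _ x 0)
    rw [apply_eq] at hm
    exact ⟨m.fst, (mk_inj.mp hm).1⟩
  obtain ⟨s, hs⟩ := Module.projective_lifting_property (homFst p) LinearMap.id hs
  have h1 : p ∘ₗ indLift φ s = LinearMap.id := ind_hom_ext (by
    ext x
    have h2 := congrArg fst (apply_eq p (indLift φ s (mk _ x 0)))
    exact h2.trans (LinearMap.congr_fun hs x))
  exact ⟨indLift φ s, fun x => LinearMap.congr_fun h1 x⟩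

end induced

/-! ### Flatness over the triangular ring and over its diagonal entries -/

section flat

/-- The inflation of `B` is projective over `T`, so inflation along `T → B` does not raise flat
dimension. -/
theorem isFlatLeft_restr_snd {G : Type u} [AddCommGroup G] [Module B G] (hG : IsFlatLeft B G) :
    IsFlatLeft (TriRing A B U) (Restr (sndHom A B U) G) :=
  have : Module.Projective (TriRing A B U) (Restr (sndHom A B U) B) := projective_restr_snd
  FlatDimLELeft.restr (n := 0) _ (IsFlatLeft.of_projective _) hG

/-- The kernel of `T → A` is the inflation of the `B`-module `U × B`, of flat dimension at most `n`.
Hence the inflation of `A` has flat dimension at most `n + 1`, and tensoring with `F` keeps the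
bound. -/
theorem flatDimLELeft_restr_fst {n : ℕ} (hU : FlatDimLELeft B n U) {F : Type u} [AddCommGroup F]
    [Module A F] (hF : IsFlatLeft A F) :
    FlatDimLELeft (TriRing A B U) (n + 1) (Restr (fstHom A B U) F) := by
  refine FlatDimLELeft.restr_of_flat _ ?_ hF
  let p : TriRing A B U →ₗ[TriRing A B U] Restr (fstHom A B U) A :=
    { toFun := fun t => Restr.of _ t.a
      map_add' := fun s t => rfl
      map_smul' := fun s t => rfl }
  have hp : ∀ t : LinearMap.ker p, t.1.a = 0 := fun t => t.2
  have : Module.Projective (TriRing A B U) (Restr (sndHom A B U) B) := projective_restr_snd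
  refine .of_surjective p (IsFlatLeft.of_projective _) (fun a => ⟨⟨a.out, 0, 0⟩, rfl⟩) ?_
  refine (FlatDimLELeft.restr (sndHom A B U) (IsFlatLeft.of_projective _)
    (hU.prod_flat (IsFlatLeft.of_projective B))).of_retract
    { toFun := fun t => Restr.of _ (t.1.u, t.1.b)
      map_add' := fun s t => rfl
      map_smul' := fun s t => Prod.ext ?_ rfl }
    { toFun := fun x => ⟨⟨0, x.out.1, x.out.2⟩, rfl⟩
      map_add' := fun x y => Subtype.ext (TriRing.ext (add_zero 0).symm rfl rfl)
      map_smul' := fun t x => Subtype.ext (TriRing.ext (mul_zero t.a).symm ?_ rfl) }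
    fun t => Subtype.ext (TriRing.ext (hp t).symm rfl rfl)
  · change MulOpposite.op t.1.a • s.u + s.b • t.1.u = s.b • t.1.u
    rw [hp, MulOpposite.op_zero, zero_smul, zero_add]
  · change t.b • x.out.1 = MulOpposite.op 0 • t.u + t.b • x.out.1
    rw [MulOpposite.op_zero, zero_smul, zero_add]

variable {M₁ M₂ : Type u} [AddCommGroup M₁] [Module A M₁] [AddCommGroup M₂] [Module B M₂]
  {φ : BalTensor A U M₁ →ₗ[B] M₂}

/-- For a right `A`-module `N` inflated to `T`, the group `N ⊗_A M₁` is a natural retract of `N ⊗_T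
M`. -/
theorem isFlatLeft_fst (h : IsFlatLeft (TriRing A B U) (TriModule φ)) : IsFlatLeft A M₁ := by
  let T := TriRing A B U
  let π : Tᵐᵒᵖ →+* Aᵐᵒᵖ := (fstHom A B U).op
  have key : ∀ (N : Type u) [AddCommGroup N] [Module Aᵐᵒᵖ N],
      ∃ (θ : BalTensor A N M₁ →+ BalTensor T (Restr π N) (TriModule φ))
        (ρ : BalTensor T (Restr π N) (TriModule φ) →+ BalTensor A N M₁),
        (∀ n x, θ (tmul A n x) = tmul T (Restr.of π n) (mk φ x 0)) ∧ ∀ z, ρ (θ z) = z := by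
    intro N _ _
    let θ : BalTensor A N M₁ →+ BalTensor T (Restr π N) (TriModule φ) :=
      lift₂ (fun n x => tmul T (Restr.of π n) (mk φ x 0)) (fun n n' x => add_tmul _ _ _)
        (fun n x y => by
          rw [← tmul_add]
          congr 1
          ext <;> simp)
        (fun n a x => by
          have h1 : mk φ (a • x) 0 = (⟨a, 0, 0⟩ : T) • mk φ x 0 := by
            ext <;> simp [zero_tmul]
          rw [h1, ← smul_tmul]
          rfl)
    let ρ : BalTensor T (Restr π N) (TriModule φ) →+ BalTensor A N M₁ :=
      lift₂ (fun n m => tmul A n.out m.fst) (fun n n' m => add_tmul _ _ _)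
        (fun n m m' => tmul_add _ _ _) (fun n t m => smul_tmul n.out t.a m.fst)
    refine ⟨θ, ρ, fun n x => rfl, fun z => ?_⟩
    induction z using induction_on with
    | zero => simp
    | tmul n x => rfl
    | add x y hx hy => rw [map_add, map_add, hx, hy]
  intro N N' _ _ _ _ f hf
  obtain ⟨θ, ρ, hθ, hρ⟩ := key N
  obtain ⟨θ', ρ', hθ', hρ'⟩ := key N'
  have nat : ∀ z, θ' (map f LinearMap.id z) = map (Restr.map π f) LinearMap.id (θ z) := by
    intro z
    induction z using induction_on with
    | zero => simp
    | tmul n x => simp only [map_tmul, hθ, hθ', LinearMap.id_apply]; rfl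
    | add x y hx hy => simp only [map_add, hx, hy]
  refine (injective_iff_map_eq_zero _).mpr fun z hz => ?_
  rw [← hρ z]
  suffices θ z = 0 by rw [this, map_zero]
  refine (injective_iff_map_eq_zero _).mp (h _ _ (Restr.map π f) hf) _ ?_
  rw [← nat, hz, map_zero]

/-- The lower row of the triangular matrix ring. -/
def LowerRow (_A B U : Type*) : Type _ := U × B

namespace LowerRow

instance instAddCommGroup : AddCommGroup (LowerRow A B U) := inferInstanceAs (AddCommGroup (U × B))

instance instModule : Module B (LowerRow A B U) := inferInstanceAs (Module B (U × B))

instance instSMul : SMul (TriRing A B U)ᵐᵒᵖ (LowerRow A B U) where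
  smul t v := (MulOpposite.op t.unop.a • v.1 + v.2 • t.unop.u, v.2 * t.unop.b)

instance instModuleOp : Module (TriRing A B U)ᵐᵒᵖ (LowerRow A B U) where
  one_smul v := Prod.ext (by
    change MulOpposite.op (1 : A) • v.1 + v.2 • (0 : U) = v.1
    simp) (mul_one v.2)
  mul_smul s t v := Prod.ext (by
    change MulOpposite.op (t.unop.a * s.unop.a) • v.1 +
      v.2 • (MulOpposite.op s.unop.a • t.unop.u + t.unop.b • s.unop.u) =
      MulOpposite.op s.unop.a • (MulOpposite.op t.unop.a • v.1 + v.2 • t.unop.u) +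
        (v.2 * t.unop.b) • s.unop.u
    rw [MulOpposite.op_mul, mul_smul, smul_add, smul_add, mul_smul, add_assoc, smul_comm v.2])
    (mul_assoc v.2 t.unop.b s.unop.b).symm
  smul_zero t := Prod.ext (by
    change MulOpposite.op t.unop.a • (0 : U) + (0 : B) • t.unop.u = 0
    simp) (zero_mul t.unop.b)
  smul_add t v w := Prod.ext (by
    change MulOpposite.op t.unop.a • (v.1 + w.1) + (v.2 + w.2) • t.unop.u =
      (MulOpposite.op t.unop.a • v.1 + v.2 • t.unop.u) +
        (MulOpposite.op t.unop.a • w.1 + w.2 • t.unop.u)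
    rw [smul_add, add_smul]
    abel) (add_mul v.2 w.2 t.unop.b)
  add_smul s t v := Prod.ext (by
    change MulOpposite.op (s.unop.a + t.unop.a) • v.1 + v.2 • (s.unop.u + t.unop.u) =
      (MulOpposite.op s.unop.a • v.1 + v.2 • s.unop.u) +
        (MulOpposite.op t.unop.a • v.1 + v.2 • t.unop.u)
    rw [smul_add, MulOpposite.op_add, add_smul]
    abel) (mul_add v.2 s.unop.b t.unop.b)
  zero_smul v := Prod.ext (by
    change MulOpposite.op (0 : A) • v.1 + v.2 • (0 : U) = 0
    simp) (mul_zero v.2)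

instance instSMulCommClass : SMulCommClass B (TriRing A B U)ᵐᵒᵖ (LowerRow A B U) where
  smul_comm b t v := Prod.ext (by
    change b • (MulOpposite.op t.unop.a • v.1 + v.2 • t.unop.u) =
      MulOpposite.op t.unop.a • (b • v.1) + (b * v.2) • t.unop.u
    rw [smul_add, mul_smul, smul_comm b]) (mul_assoc b v.2 t.unop.b).symm

end LowerRow

/-- `M₂` is a retract of the tensor product over `T` of the lower row `(U, B)` with `M`, through `y
↦ (0, 1) ⊗ (0, y)`. -/
theorem flatDimLELeft_snd {n : ℕ} (hU : FlatDimLELeft B n U)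
    (h : IsFlatLeft (TriRing A B U) (TriModule φ)) : FlatDimLELeft B n M₂ := by
  have hV : FlatDimLELeft B n (LowerRow A B U) := hU.prod_flat (IsFlatLeft.of_projective B)
  let c : U → B → LowerRow A B U := fun x y => (x, y)
  have hc : ∀ (t : TriRing A B U) x y,
      MulOpposite.op t • c x y = c (MulOpposite.op t.a • x + y • t.u) (y * t.b) :=
    fun _ _ _ => rfl
  have hb : ∀ (b : B) x y, b • c x y = c (b • x) (b * y) := fun _ _ _ => rfl
  let ρ : BalTensor (TriRing A B U) (LowerRow A B U) (TriModule φ) →+ M₂ :=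
    lift₂ (fun v m => φ (tmul A v.1 m.fst) + v.2 • m.snd)
      (fun v w m => by
        change φ (tmul A (v.1 + w.1) m.fst) + (v.2 + w.2) • m.snd = _
        rw [add_tmul, map_add, add_smul]
        abel)
      (fun v m m' => by
        rw [fst_add, snd_add, tmul_add, map_add, smul_add]
        abel)
      (fun v t m => by
        change φ (tmul A (MulOpposite.op t.a • v.1 + v.2 • t.u) m.fst) + (v.2 * t.b) • m.snd = _
        rw [fst_smul, snd_smul, add_tmul, map_add, smul_tmul, ← smul_tmul_left, map_smul, smul_add,
          mul_smul, add_assoc])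
  refine (hV.balTensor h).of_retract
    { toFun := fun y => tmul _ (c 0 1) (mk φ 0 y)
      map_add' := fun x y => ?_
      map_smul' := fun b y => ?_ }
    { toFun := ρ
      map_add' := ρ.map_add
      map_smul' := fun b z => ?_ } fun y => ?_
  · rw [← tmul_add]
    congr 1
    ext <;> simp
  · have h1 : mk φ 0 (b • y) = (⟨0, 0, b⟩ : TriRing A B U) • mk φ 0 y := by
      ext <;> simp [zero_tmul]
    rw [h1, ← smul_tmul, hc, RingHom.id_apply, smul_tmul_left, hb]
    simp
  · rw [RingHom.id_apply]
    induction z using induction_on with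
    | zero => simp
    | tmul v m =>
      rw [smul_tmul_left]
      change φ (tmul A (b • v.1) m.fst) + (b * v.2) • m.snd =
        b • (φ (tmul A v.1 m.fst) + v.2 • m.snd)
      rw [← smul_tmul_left, map_smul, smul_add, mul_smul]
    | add x y hx hy => rw [smul_add, map_add, map_add, hx, hy, smul_add]
  · change φ (tmul A (0 : U) (0 : M₁)) + (1 : B) • y = y
    rw [zero_tmul, map_zero, zero_add, one_smul]

end flat

end TriModule

theorem IsShortExact.congr {R X Y Z X' Y' Z' : Type*} [Ring R] [AddCommGroup X] [Module R X]
    [AddCommGroup Y] [Module R Y] [AddCommGroup Z] [Module R Z] [AddCommGroup X'] [Module R X']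
    [AddCommGroup Y'] [Module R Y'] [AddCommGroup Z'] [Module R Z'] {i : X →ₗ[R] Y} {p : Y →ₗ[R] Z}
    (h : IsShortExact i p) (e : X ≃ₗ[R] X') (f : Y ≃ₗ[R] Y') (g : Z ≃ₗ[R] Z') :
    IsShortExact (f.toLinearMap ∘ₗ i ∘ₗ e.symm.toLinearMap)
      (g.toLinearMap ∘ₗ p ∘ₗ f.symm.toLinearMap) := by
  refine ⟨f.injective.comp (h.inj.comp e.symm.injective), fun y => ⟨fun hy => ?_, ?_⟩,
    g.surjective.comp (h.surj.comp f.symm.surjective)⟩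
  · obtain ⟨x, hx⟩ := (h.exact (f.symm y)).mp (g.injective (hy.trans (map_zero g).symm))
    exact ⟨e x, by simp [hx]⟩
  · rintro ⟨x, rfl⟩
    simp [h.zero]

/-! ### Necessity: the entries of a Ding projective triple -/

namespace TriModule

variable {A B U : Type u} [Ring A] [Ring B] [AddCommGroup U] [Module B U] [Module Aᵐᵒᵖ U]
  [SMulCommClass B Aᵐᵒᵖ U]

section forward

variable {M₁ M₂ : Type u} [AddCommGroup M₁] [Module A M₁] [AddCommGroup M₂] [Module B M₂]
  {φ : BalTensor A U M₁ →ₗ[B] M₂}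

theorem exists_syz (h : IsDingProjective (TriRing A B U) (TriModule φ)) :
    ∃ (K₁ P₁ : ModuleCat.{u} A) (K₂ P₂ : ModuleCat.{u} B) (κ : BalTensor A U K₁ →ₗ[B] K₂)
      (ρ : BalTensor A U P₁ →ₗ[B] P₂) (i : TriModule κ →ₗ[TriRing A B U] TriModule ρ)
      (p : TriModule ρ →ₗ[TriRing A B U] TriModule φ),
      Module.Projective (TriRing A B U) (TriModule ρ) ∧ IsShortExact i p ∧
        IsDingProjective (TriRing A B U) (TriModule κ) := by
  obtain ⟨K, P, i, p, hP, hi, hK⟩ := h.exists_syz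
  obtain ⟨K₁, K₂, κ, ⟨e⟩⟩ := exists_equiv A B U K
  obtain ⟨P₁, P₂, ρ, ⟨f⟩⟩ := exists_equiv A B U P
  exact ⟨K₁, P₁, K₂, P₂, κ, ρ, _, _, Module.Projective.of_equiv f,
    hi.congr e f (LinearEquiv.refl _ _), hK.of_equiv e⟩

theorem exists_cosyz (h : IsDingProjective (TriRing A B U) (TriModule φ)) :
    ∃ (P₁ K₁ : ModuleCat.{u} A) (P₂ K₂ : ModuleCat.{u} B) (ρ : BalTensor A U P₁ →ₗ[B] P₂)
      (κ : BalTensor A U K₁ →ₗ[B] K₂) (i : TriModule φ →ₗ[TriRing A B U] TriModule ρ)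
      (p : TriModule ρ →ₗ[TriRing A B U] TriModule κ),
      Module.Projective (TriRing A B U) (TriModule ρ) ∧ IsShortExact i p ∧
        IsDingProjective (TriRing A B U) (TriModule κ) := by
  obtain ⟨P, K, i, p, hP, hi, hK⟩ := h.exists_cosyz
  obtain ⟨K₁, K₂, κ, ⟨e⟩⟩ := exists_equiv A B U K
  obtain ⟨P₁, P₂, ρ, ⟨f⟩⟩ := exists_equiv A B U P
  exact ⟨P₁, K₁, P₂, K₂, ρ, κ, _, _, Module.Projective.of_equiv f,
    hi.congr (LinearEquiv.refl _ _) f e, hK.of_equiv e⟩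

/-- The upper entries of Ding projective `T`-modules form a Ding class. For `Ext¹`, a map `K₁ → F`
is a `T`-linear map into the inflation of `F`, which has flat dimension at most `n + 1`. -/
theorem isDingProjective_fst {n : ℕ} (hU : FlatDimLELeft B n U)
    (h : IsDingProjective (TriRing A B U) (TriModule φ)) : IsDingProjective A M₁ := by
  refine IsDingClass.isDingProjective (R := A)
    (𝒢 := fun N => ∃ (M₂ : ModuleCat.{u} B) (φ : BalTensor A U N →ₗ[B] M₂),
      IsDingProjective (TriRing A B U) (TriModule φ))
    ⟨?_, ?_, ?_⟩ M₁ ⟨ModuleCat.of B M₂, φ, h⟩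
  · rintro N ⟨M₂, φ, h⟩
    obtain ⟨K₁, P₁, K₂, P₂, κ, ρ, i, p, hP, hi, hK⟩ := exists_syz h
    exact ⟨K₁, P₁, homFst i, homFst p, projective_fst (φ := ρ), (isShortExact_iff.mp hi).1,
      K₂, κ, hK⟩
  · rintro N ⟨M₂, φ, h⟩
    obtain ⟨P₁, K₁, P₂, K₂, ρ, κ, i, p, hP, hi, hK⟩ := exists_cosyz h
    exact ⟨P₁, K₁, homFst i, homFst p, projective_fst (φ := ρ), (isShortExact_iff.mp hi).1,
      K₂, κ, hK⟩
  · rintro N ⟨M₂, φ, h⟩ F _ _ hF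
    obtain ⟨K₁, P₁, K₂, P₂, κ, ρ, i, p, hP, hi, hK⟩ := exists_syz h
    have := projective_fst (φ := ρ)
    refine ExtVanishes.of_projective (isShortExact_iff.mp hi).1 fun f => ?_
    obtain ⟨k, hk⟩ := h.extVanishes (flatDimLELeft_restr_fst hU hF) _ _ i p hi (toRestrFst κ f)
    obtain ⟨g, hg⟩ := exists_ofRestrFst k
    exact ⟨g, fun x => (hg _).symm.trans (hk (mk κ x 0))⟩

theorem injective_of_isDingProjective {m n : ℕ} (hUA : FlatDimLERight A m U)
    (hU : FlatDimLELeft B n U) (h : IsDingProjective (TriRing A B U) (TriModule φ)) :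
    Function.Injective φ := by
  obtain ⟨P₁, K₁, P₂, K₂, ρ, κ, i, p, hP, hi, hK⟩ := exists_cosyz h
  -- The upper entry of the cokernel is Ding projective, so `U ⊗ M₁ → U ⊗ P₁` is injective; the
  -- structure map of the projective triple is injective as well.
  have h1 := IsDingProjective.map_injective hUA (isShortExact_iff.mp hi).1
    (isDingProjective_fst hU hK)
  intro x y hxy
  refine h1 (injective_of_projective (φ := ρ) ?_)
  have h2 := congrArg (homSnd i) hxy
  rwa [homSnd_apply, homSnd_apply] at h2

/-- The snake lemma; only the third structure map must be injective. Cokernels are given by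
arbitrary maps `q`, so that the lemma applies to any module playing the role of the cokernel. -/
theorem exists_isShortExact_coker {M₁' M₂' M₁'' M₂'' C C' C'' : Type u}
    [AddCommGroup M₁'] [Module A M₁'] [AddCommGroup M₂'] [Module B M₂']
    [AddCommGroup M₁''] [Module A M₁''] [AddCommGroup M₂''] [Module B M₂'']
    [AddCommGroup C] [Module B C] [AddCommGroup C'] [Module B C'] [AddCommGroup C''] [Module B C'']
    {φ' : BalTensor A U M₁' →ₗ[B] M₂'} {φ'' : BalTensor A U M₁'' →ₗ[B] M₂''}
    {f : TriModule φ' →ₗ[TriRing A B U] TriModule φ}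
    {g : TriModule φ →ₗ[TriRing A B U] TriModule φ''} (h : IsShortExact f g)
    (hφ'' : Function.Injective φ'')
    {q : M₂ →ₗ[B] C} (hq : Function.Surjective q) (hφq : Function.Exact φ q)
    {q' : M₂' →ₗ[B] C'} (hq' : Function.Surjective q') (hφq' : Function.Exact φ' q')
    {q'' : M₂'' →ₗ[B] C''} (hq'' : Function.Surjective q'') (hφq'' : Function.Exact φ'' q'') :
    ∃ (a : C' →ₗ[B] C) (b : C →ₗ[B] C''), IsShortExact a b ∧
      (∀ y, a (q' y) = q (homSnd f y)) ∧ ∀ y, b (q y) = q'' (homSnd g y) := by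
  obtain ⟨h₁, h₂⟩ := isShortExact_iff.mp h
  obtain ⟨a, ha⟩ := exists_desc q' hq' (q ∘ₗ homSnd f) fun y hy => by
    obtain ⟨z, rfl⟩ := (hφq' y).mp hy
    rw [LinearMap.comp_apply, homSnd_apply]
    exact hφq.apply_apply_eq_zero _
  obtain ⟨b, hb⟩ := exists_desc q hq (q'' ∘ₗ homSnd g) fun y hy => by
    obtain ⟨z, rfl⟩ := (hφq y).mp hy
    rw [LinearMap.comp_apply, homSnd_apply]
    exact hφq''.apply_apply_eq_zero _
  refine ⟨a, b, ⟨(injective_iff_map_eq_zero a).mpr fun c hc => ?_, fun c => ⟨fun hc => ?_, ?_⟩,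
    fun c => ?_⟩, ha, hb⟩
  · obtain ⟨y, rfl⟩ := hq' c
    rw [ha] at hc
    obtain ⟨z, hz⟩ := (hφq _).mp hc
    have h3 : lmap B U (homFst g) z = 0 := hφ'' (by
      rw [← homSnd_apply, hz, h₂.zero, map_zero])
    obtain ⟨w, rfl⟩ := map_right_exact h₁.exact h₁.surj z h3
    have h4 : φ' w = y := h₂.inj (by rw [homSnd_apply]; exact hz)
    rw [← h4]
    exact hφq'.apply_apply_eq_zero _
  · obtain ⟨y, rfl⟩ := hq c
    rw [hb] at hc
    obtain ⟨z'', hz''⟩ := (hφq'' _).mp hc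
    obtain ⟨z, rfl⟩ := map_surjective (f := (LinearMap.id : U →ₗ[Aᵐᵒᵖ] U))
      Function.surjective_id h₁.surj z''
    obtain ⟨w, hw⟩ := (h₂.exact (y - φ z)).mp (by
      rw [map_sub, homSnd_apply, sub_eq_zero]
      exact hz''.symm)
    refine ⟨q' w, ?_⟩
    rw [ha, LinearMap.comp_apply, hw, map_sub, hφq.apply_apply_eq_zero, sub_zero]
  · rintro ⟨c, rfl⟩
    obtain ⟨y, rfl⟩ := hq' c
    rw [ha, LinearMap.comp_apply, hb, LinearMap.comp_apply, h₂.zero, map_zero]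
  · obtain ⟨y, rfl⟩ := hq'' c
    obtain ⟨y, rfl⟩ := h₂.surj y
    exact ⟨q y, hb y⟩

/-- The cokernels of structure maps of Ding projective triples form a Ding class. For `Ext¹`, a map
from a cokernel to a flat `F` is a `T`-linear map into the inflation of `F`, which is flat. -/
theorem isDingProjective_coker {m n : ℕ} (hUA : FlatDimLERight A m U)
    (hU : FlatDimLELeft B n U) (h : IsDingProjective (TriRing A B U) (TriModule φ)) :
    IsDingProjective B (M₂ ⧸ LinearMap.range φ) := by
  have hmk : ∀ {M₁ : ModuleCat.{u} A} {M₂ : ModuleCat.{u} B} (φ : BalTensor A U M₁ →ₗ[B] M₂),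
      Function.Exact φ (LinearMap.range φ).mkQ := fun φ =>
    LinearMap.exact_iff.mpr (by simp)
  refine IsDingClass.isDingProjective (R := B)
    (𝒢 := fun C => ∃ (M₁ : ModuleCat.{u} A) (M₂ : ModuleCat.{u} B)
      (φ : BalTensor A U M₁ →ₗ[B] M₂) (q : M₂ →ₗ[B] C), Function.Surjective q ∧
      Function.Exact φ q ∧ IsDingProjective (TriRing A B U) (TriModule φ))
    ⟨?_, ?_, ?_⟩ (M₂ ⧸ LinearMap.range φ) ⟨ModuleCat.of A M₁, ModuleCat.of B M₂, φ,
      (LinearMap.range φ).mkQ, Submodule.mkQ_surjective _, hmk (M₁ := .of A M₁) (M₂ := .of B M₂) φ,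
      h⟩
  · rintro C ⟨M₁, M₂, φ, q, hq, hφ, h⟩
    obtain ⟨K₁, P₁, K₂, P₂, κ, ρ, i, p, hP, hi, hK⟩ := exists_syz h
    obtain ⟨a, b, hab, -, -⟩ := exists_isShortExact_coker hi
      (injective_of_isDingProjective hUA hU h) (Submodule.mkQ_surjective _) (hmk ρ)
      (Submodule.mkQ_surjective _) (hmk κ) hq hφ
    exact ⟨ModuleCat.of B (K₂ ⧸ LinearMap.range κ), ModuleCat.of B (P₂ ⧸ LinearMap.range ρ), a, b,
      projective_coker (φ := ρ) (Submodule.mkQ_surjective _) (hmk ρ), hab, K₁, K₂, κ, _,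
      Submodule.mkQ_surjective _, hmk κ, hK⟩
  · rintro C ⟨M₁, M₂, φ, q, hq, hφ, h⟩
    obtain ⟨P₁, K₁, P₂, K₂, ρ, κ, i, p, hP, hi, hK⟩ := exists_cosyz h
    obtain ⟨a, b, hab, -, -⟩ := exists_isShortExact_coker hi
      (injective_of_isDingProjective hUA hU hK) (Submodule.mkQ_surjective _) (hmk ρ)
      hq hφ (Submodule.mkQ_surjective _) (hmk κ)
    exact ⟨ModuleCat.of B (P₂ ⧸ LinearMap.range ρ), ModuleCat.of B (K₂ ⧸ LinearMap.range κ), a, b,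
      projective_coker (φ := ρ) (Submodule.mkQ_surjective _) (hmk ρ), hab, K₁, K₂, κ, _,
      Submodule.mkQ_surjective _, hmk κ, hK⟩
  · rintro C ⟨M₁, M₂, φ, q, hq, hφ, h⟩ F _ _ hF
    obtain ⟨K₁, P₁, K₂, P₂, κ, ρ, i, p, hP, hi, hK⟩ := exists_syz h
    obtain ⟨a, b, hab, ha, -⟩ := exists_isShortExact_coker hi
      (injective_of_isDingProjective hUA hU h) (Submodule.mkQ_surjective _) (hmk ρ)
      (Submodule.mkQ_surjective _) (hmk κ) hq hφ
    have := projective_coker (φ := ρ) (Submodule.mkQ_surjective _) (hmk ρ)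
    refine ExtVanishes.of_projective hab fun f => ?_
    obtain ⟨k, hk⟩ := h.extVanishes (n := 0) (isFlatLeft_restr_snd hF) _ _ i p hi
      (toRestrSnd κ (f ∘ₗ (LinearMap.range κ).mkQ) (fun z => by
        rw [LinearMap.comp_apply, (hmk κ).apply_apply_eq_zero, map_zero]))
    obtain ⟨g, hg0, hg⟩ := exists_ofRestrSnd k
    obtain ⟨l, hl⟩ := exists_desc (LinearMap.range ρ).mkQ (Submodule.mkQ_surjective _) g
      fun y hy => by
        obtain ⟨z, rfl⟩ := (hmk ρ y).mp hy
        exact hg0 z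
    refine ⟨l, fun x => ?_⟩
    obtain ⟨y, rfl⟩ := Submodule.mkQ_surjective _ x
    rw [ha, hl]
    exact (hg _).symm.trans (hk (mk κ 0 y))

end forward

/-! ### Sufficiency: building Ding projective triples -/

section backward

theorem extVanishes_of_tri {G : Type u} [AddCommGroup G] [Module (TriRing A B U) G]
    (h : ∀ (M₁ : ModuleCat.{u} A) (M₂ : ModuleCat.{u} B) (φ : BalTensor A U M₁ →ₗ[B] M₂),
      IsFlatLeft (TriRing A B U) (TriModule φ) → ExtVanishes (TriRing A B U) G (TriModule φ))
    {F : Type u} [AddCommGroup F] [Module (TriRing A B U) F] (hF : IsFlatLeft (TriRing A B U) F) :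
    ExtVanishes (TriRing A B U) G F := by
  obtain ⟨M₁, M₂, φ, ⟨e⟩⟩ := exists_equiv A B U F
  exact (h M₁ M₂ φ (hF.of_retract e.symm.toLinearMap e.toLinearMap (by simp))).of_iso e.symm

/-- Inflation is exact and preserves projectives. A map from an inflated module to `(M₁, M₂)` is a
map to `M₂`, and this has finite flat dimension if the triple is flat. -/
theorem isDingProjective_restr_snd {n : ℕ} (hU : FlatDimLELeft B n U) {C : Type u} [AddCommGroup C]
    [Module B C] (h : IsDingProjective B C) :
    IsDingProjective (TriRing A B U) (Restr (sndHom A B U) C) := by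
  refine IsDingClass.isDingProjective (R := TriRing A B U)
    (𝒢 := fun G => ∃ C : ModuleCat.{u} B, IsDingProjective B C ∧
      Nonempty (Restr (sndHom A B U) C ≃ₗ[TriRing A B U] G))
    ⟨?_, ?_, ?_⟩ _ ⟨ModuleCat.of B C, h, ⟨LinearEquiv.refl _ _⟩⟩
  · rintro G ⟨C, h, ⟨e⟩⟩
    obtain ⟨K, P, i, p, hP, hi, hK⟩ := h.exists_syz
    exact ⟨ModuleCat.of _ (Restr (sndHom A B U) K), ModuleCat.of _ (Restr (sndHom A B U) P), _, _,
      projective_restr_snd (P := P),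
      (Restr.map_isShortExact _ hi).congr (LinearEquiv.refl _ _) (LinearEquiv.refl _ _) e, K, hK,
      ⟨LinearEquiv.refl _ _⟩⟩
  · rintro G ⟨C, h, ⟨e⟩⟩
    obtain ⟨P, K, i, p, hP, hi, hK⟩ := h.exists_cosyz
    exact ⟨ModuleCat.of _ (Restr (sndHom A B U) P), ModuleCat.of _ (Restr (sndHom A B U) K), _, _,
      projective_restr_snd (P := P),
      (Restr.map_isShortExact _ hi).congr e (LinearEquiv.refl _ _) (LinearEquiv.refl _ _), K, hK,
      ⟨LinearEquiv.refl _ _⟩⟩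
  · rintro G ⟨C, h, ⟨e⟩⟩ F _ _ hF
    refine extVanishes_of_tri (fun M₁ M₂ φ hφ => ?_) hF
    obtain ⟨K, P, i, p, hP, hi, hK⟩ := h.exists_syz
    have : Module.Projective (TriRing A B U) (Restr (sndHom A B U) P) := projective_restr_snd
    refine ExtVanishes.of_projective ((Restr.map_isShortExact (sndHom A B U) hi).congr
      (LinearEquiv.refl _ _) (LinearEquiv.refl _ _) e) fun f => ?_
    obtain ⟨k, hk⟩ := exists_toRestrSnd f
    obtain ⟨g, hg⟩ := h.extVanishes (flatDimLELeft_snd hU hφ) _ _ i p hi k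
    exact ⟨ofRestrSnd φ g, fun x => (congrArg (mk φ 0) (hg x.out)).trans (hk x).symm⟩

/-- Vanishing of `Tor₁` against `U` makes induction exact on syzygy and cosyzygy sequences. Maps out
of an induced module are maps into the upper entry, which is flat if the target is. -/
theorem isDingProjective_ind {m : ℕ} (hUA : FlatDimLERight A m U) {N : Type u} [AddCommGroup N]
    [Module A N] (h : IsDingProjective A N) : IsDingProjective (TriRing A B U) (Ind A B U N) := by
  refine IsDingClass.isDingProjective (R := TriRing A B U)
    (𝒢 := fun G => ∃ N : ModuleCat.{u} A, IsDingProjective A N ∧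
      Nonempty (Ind A B U N ≃ₗ[TriRing A B U] G))
    ⟨?_, ?_, ?_⟩ _ ⟨ModuleCat.of A N, h, ⟨LinearEquiv.refl _ _⟩⟩
  · rintro G ⟨N, h, ⟨e⟩⟩
    obtain ⟨K, P, i, p, hP, hi, hK⟩ := h.exists_syz
    exact ⟨ModuleCat.of _ (Ind A B U K), ModuleCat.of _ (Ind A B U P), _, _,
      projective_ind (N := P),
      (indLift_isShortExact hi (h.map_injective hUA hi)).congr (LinearEquiv.refl _ _)
        (LinearEquiv.refl _ _) e, K, hK, ⟨LinearEquiv.refl _ _⟩⟩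
  · rintro G ⟨N, h, ⟨e⟩⟩
    obtain ⟨P, K, i, p, hP, hi, hK⟩ := h.exists_cosyz
    exact ⟨ModuleCat.of _ (Ind A B U P), ModuleCat.of _ (Ind A B U K), _, _,
      projective_ind (N := P),
      (indLift_isShortExact hi (hK.map_injective hUA hi)).congr e (LinearEquiv.refl _ _)
        (LinearEquiv.refl _ _), K, hK, ⟨LinearEquiv.refl _ _⟩⟩
  · rintro G ⟨N, h, ⟨e⟩⟩ F _ _ hF
    refine extVanishes_of_tri (fun M₁ M₂ φ hφ => ?_) hF
    obtain ⟨K, P, i, p, hP, hi, hK⟩ := h.exists_syz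
    have : Module.Projective (TriRing A B U) (Ind A B U P) := projective_ind
    refine ExtVanishes.of_projective ((indLift_isShortExact hi
      (h.map_injective hUA hi)).congr (LinearEquiv.refl _ _) (LinearEquiv.refl _ _) e) fun f => ?_
    obtain ⟨g, hg⟩ := h.extVanishes (n := 0) (isFlatLeft_fst hφ) _ _ i p hi (homFst f)
    refine ⟨indLift φ g, LinearMap.congr_fun (f := indLift φ g ∘ₗ indLift _ i)
      (ind_hom_ext (LinearMap.ext hg))⟩

/-- The sequence `0 → (M₁, U ⊗ M₁) → M → (0, coker φ) → 0` is exact because `φ` is injective. -/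
theorem isDingProjective_of_components {m n : ℕ} (hUA : FlatDimLERight A m U)
    (hU : FlatDimLELeft B n U) {M₁ M₂ : Type u} [AddCommGroup M₁] [Module A M₁] [AddCommGroup M₂]
    [Module B M₂] {φ : BalTensor A U M₁ →ₗ[B] M₂} (h₁ : IsDingProjective A M₁)
    (h₂ : IsDingProjective B (M₂ ⧸ LinearMap.range φ)) (hφ : Function.Injective φ) :
    IsDingProjective (TriRing A B U) (TriModule φ) := by
  have hmk := IsShortExact.of_mkQ φ hφ
  refine IsDingProjective.extension
    (a := homMk LinearMap.id φ LinearMap.id φ fun u x => rfl)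
    (b := toRestrSnd φ (LinearMap.range φ).mkQ hmk.zero) ?_
    (isDingProjective_ind (B := B) hUA h₁) (isDingProjective_restr_snd hU h₂)
  refine ⟨fun x y hxy => ?_, fun x => ⟨fun hx => ?_, ?_⟩, fun x => ?_⟩
  · obtain ⟨e₁, e₂⟩ := mk_inj.mp hxy
    exact ext e₁ (hφ e₂)
  · obtain ⟨z, hz⟩ := (hmk.exact x.snd).mp hx
    exact ⟨mk _ x.fst z, ext rfl hz⟩
  · rintro ⟨y, rfl⟩
    exact hmk.zero _
  · obtain ⟨y, hy⟩ := hmk.surj x.out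
    exact ⟨mk φ 0 y, hy⟩

end backward

end TriModule

theorem theorem3p4 {A B U : Type u} [Ring A] [Ring B]
    [AddCommGroup U] [Module B U] [Module Aᵐᵒᵖ U] [SMulCommClass B Aᵐᵒᵖ U]
    (hUA : FiniteFlatDimRight A U) (hBU : FiniteFlatDimLeft B U)
    {M₁ M₂ : Type u} [AddCommGroup M₁] [Module A M₁] [AddCommGroup M₂] [Module B M₂]
    (φ : BalTensor A U M₁ →ₗ[B] M₂) :
    (IsDingProjective (TriRing A B U) (TriModule φ) ↔
      IsDingProjective A M₁ ∧ IsDingProjective B (M₂ ⧸ LinearMap.range φ) ∧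
        Function.Injective φ) ∧
    (IsDingProjective (TriRing A B U) (TriModule φ) →
      (IsDingProjective B (BalTensor A U M₁) ↔ IsDingProjective B M₂)) := by
  obtain ⟨m, hUA⟩ := hUA
  obtain ⟨n, hBU⟩ := hBU
  have hfwd : IsDingProjective (TriRing A B U) (TriModule φ) →
      IsDingProjective A M₁ ∧ IsDingProjective B (M₂ ⧸ LinearMap.range φ) ∧
        Function.Injective φ := fun h =>
    ⟨TriModule.isDingProjective_fst hBU h, TriModule.isDingProjective_coker hUA hBU h,
      TriModule.injective_of_isDingProjective hUA hBU h⟩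
  refine ⟨⟨hfwd, fun ⟨h₁, h₂, h₃⟩ =>
    TriModule.isDingProjective_of_components hUA hBU h₁ h₂ h₃⟩, fun h => ?_⟩
  obtain ⟨-, hC, hφ⟩ := hfwd h
  exact ⟨fun h₁ => IsDingProjective.extension (IsShortExact.of_mkQ φ hφ) h₁ hC,
    fun h₂ => IsDingProjective.of_isShortExact (IsShortExact.of_mkQ φ hφ) h₂ hC⟩
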